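/- For real numbers $\alpha_1,\alpha_2$ let $\mu_L(\alpha_1,\alpha_2)\in[-\infty,+\infty]$ be the supremum of the real numbers $\mu$ such that the inequality \[|h_0+h_1\alpha_1+h_2\alpha_2|<h^{-\mu},\qquad h=\max\{|h_0|,|h_1|,|h_2|\},\] has infinitely many solutions $(h_0,h_1,h_2)\in\mathbb Z^3\setminus\{(0,0,0)\}$. Let $(a_n)_{n\ge 0}$ and $(b_n)_{n\ge 0}$ be defined by $a_0=b_0=0$, $a_1=b_1=1$ and, for all $n\ge 1$, \[a_{2n}=a_n,\quad a_{2n+1}=a_n+a_{n+1},\quad b_{2n}=-b_n,\quad b_{2n+1}=-(b_n+b_{n+1}).\] For real $z$ with $|z|<1$ put \[A(z)=\sum_{n\ge 0}a_{n+1}z^n,\qquad B(z)=\sum_{n\ge 0}b_{n+1}z^n,\] \[T(z)=\prod_{j=0}^{\infty}\bigl(1-z^{2^j}\bigr),\qquad M(z)=\sum_{j=0}^{\infty}\frac{(-1)^j z^{2^j}}{\prod_{i=0}^{j-1}\bigl(1-z^{2^i}\bigr)},\] \[G_3(z)=\sum_{k=0}^{\infty}\frac{z^{3^k}}{1-z^{3^k}},\qquad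 F_3(z)=\sum_{k=0}^{\infty}\frac{z^{3^k}}{1+z^{3^k}}.\] Then for all integers $b\ge 2$, \[\mu_L\bigl(A(1/b),B(1/b)\bigr)\le 3,\qquad \mu_L\bigl(T(1/b),M(1/b)\bigr)\le 15,\qquad \mu_L\bigl(G_3(1/b),F_3(1/b)\bigr)\le 17.\] -/

import Mathlib

/-- Stern's sequence: `a 0 = 0`, `a 1 = 1`, `a (2n) = a n`, `a (2n+1) = a n + a (n+1)`. -/
def sternSeq : ℕ → ℤ
  | 0 => 0
  | 1 => 1
  | n + 2 =>
    if n % 2 = 0 then sternSeq (n / 2 + 1)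
    else sternSeq (n / 2 + 1) + sternSeq (n / 2 + 2)
  decreasing_by all_goals omega

/-- The twisted Stern sequence: `b 0 = 0`, `b 1 = 1`, and for `n ≥ 1`
`b (2n) = - b n`, `b (2n+1) = -(b n + b (n+1))`. -/
def twistedSternSeq : ℕ → ℤ
  | 0 => 0
  | 1 => 1
  | n + 2 =>
    if n % 2 = 0 then -twistedSternSeq (n / 2 + 1)
    else -(twistedSternSeq (n / 2 + 1) + twistedSternSeq (n / 2 + 2))
  decreasing_by all_goals omega

theorem sternSeq_even (n : ℕ) (hn : 1 ≤ n) : sternSeq (2 * n) = sternSeq n := by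
  obtain ⟨m, rfl⟩ := Nat.exists_eq_add_of_le' hn
  rw [show 2 * (m + 1) = 2 * m + 2 by ring, sternSeq, if_pos (by omega)]
  congr 1; omega

theorem sternSeq_odd (n : ℕ) (hn : 1 ≤ n) :
    sternSeq (2 * n + 1) = sternSeq n + sternSeq (n + 1) := by
  obtain ⟨m, rfl⟩ := Nat.exists_eq_add_of_le' hn
  rw [show 2 * (m + 1) + 1 = (2 * m + 1) + 2 by ring, sternSeq, if_neg (by omega)]
  congr 2 <;> omega

theorem twistedSternSeq_even (n : ℕ) (hn : 1 ≤ n) :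
    twistedSternSeq (2 * n) = -twistedSternSeq n := by
  obtain ⟨m, rfl⟩ := Nat.exists_eq_add_of_le' hn
  rw [show 2 * (m + 1) = 2 * m + 2 by ring, twistedSternSeq, if_pos (by omega)]
  congr 2; omega

theorem twistedSternSeq_odd (n : ℕ) (hn : 1 ≤ n) :
    twistedSternSeq (2 * n + 1) = -(twistedSternSeq n + twistedSternSeq (n + 1)) := by
  obtain ⟨m, rfl⟩ := Nat.exists_eq_add_of_le' hn
  rw [show 2 * (m + 1) + 1 = (2 * m + 1) + 2 by ring, twistedSternSeq, if_neg (by omega)]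
  congr 3 <;> omega

/-- `A(z) = ∑ a (n+1) z ^ n`, for `|z| < 1`. -/
noncomputable def sternA (z : ℝ) : ℝ := ∑' n : ℕ, (sternSeq (n + 1) : ℝ) * z ^ n

/-- `B(z) = ∑ b (n+1) z ^ n`, for `|z| < 1`. -/
noncomputable def sternB (z : ℝ) : ℝ := ∑' n : ℕ, (twistedSternSeq (n + 1) : ℝ) * z ^ n

/-- The Thue-Morse product `T(z) = ∏ (1 - z ^ (2 ^ j))`, for `|z| < 1`. -/
noncomputable def thueMorseT (z : ℝ) : ℝ := ∏' j : ℕ, (1 - z ^ (2 ^ j))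

/-- `M(z) = ∑ (-1) ^ j z ^ (2 ^ j) / ∏_{i < j} (1 - z ^ (2 ^ i))`, for `|z| < 1`. -/
noncomputable def thueMorseM (z : ℝ) : ℝ :=
  ∑' j : ℕ, (-1) ^ j * z ^ (2 ^ j) / ∏ i ∈ Finset.range j, (1 - z ^ (2 ^ i))

/-- `G_d(z) = ∑ z ^ (d ^ k) / (1 - z ^ (d ^ k))`, for `d ≥ 2` and `|z| < 1`. -/
noncomputable def lambertG (d : ℕ) (z : ℝ) : ℝ := ∑' k : ℕ, z ^ (d ^ k) / (1 - z ^ (d ^ k))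

/-- `F_d(z) = ∑ z ^ (d ^ k) / (1 + z ^ (d ^ k))`, for `d ≥ 2` and `|z| < 1`. -/
noncomputable def lambertF (d : ℕ) (z : ℝ) : ℝ := ∑' k : ℕ, z ^ (d ^ k) / (1 + z ^ (d ^ k))

/-- The height `max |h_i|` of an integer triple. -/
def tripleHeight (h : Fin 3 → ℤ) : ℤ := max |h 0| (max |h 1| |h 2|)

/-- The nonzero integer triples `h` with `|h₀ + h₁ α₁ + h₂ α₂| < (max |h_i|) ^ (-μ)`. -/
def linFormSolutions (α₁ α₂ μ : ℝ) : Set (Fin 3 → ℤ) :=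
  {h | h ≠ 0 ∧ |(h 0 : ℝ) + (h 1 : ℝ) * α₁ + (h 2 : ℝ) * α₂| < (tripleHeight h : ℝ) ^ (-μ)}

/-- The linear independence exponent `μ_L(α₁, α₂)`: the supremum, in the extended reals, of the
real `μ` for which there are infinitely many solutions (so it is `⊤` if these are unbounded). -/
noncomputable def linIndepExponent (α₁ α₂ : ℝ) : EReal :=
  sSup {x : EReal | ∃ μ : ℝ, x = (μ : EReal) ∧ (linFormSolutions α₁ α₂ μ).Infinite}

section Convergence

theorem abs_sternSeq_le (n : ℕ) : |sternSeq n| ≤ n ∧ |twistedSternSeq n| ≤ n := by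
  induction n using Nat.strong_induction_on with
  | _ n ih =>
    match n, ih with
    | 0, _ => simp [sternSeq, twistedSternSeq]
    | 1, _ => simp [sternSeq, twistedSternSeq]
    | n + 2, ih =>
      have h1 := ih (n / 2 + 1) (by omega)
      rw [sternSeq, twistedSternSeq]
      split_ifs with h
      · rw [abs_neg]; omega
      · have h2 := ih (n / 2 + 2) (by omega)
        simp only [abs_le] at *
        omega

theorem summable_sternA {z : ℝ} (hz : |z| < 1) :
    Summable fun n : ℕ => (sternSeq (n + 1) : ℝ) * z ^ n := by
  have h := (summable_pow_mul_geometric_of_norm_lt_one 1 (r := |z|) (by simpa using hz)).add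
    (summable_geometric_of_lt_one (abs_nonneg z) hz)
  refine Summable.of_norm_bounded h fun n => ?_
  have h1 : |(sternSeq (n + 1) : ℝ)| ≤ n + 1 := by exact_mod_cast (abs_sternSeq_le (n + 1)).1
  rw [norm_mul, norm_pow, Real.norm_eq_abs, Real.norm_eq_abs]
  nlinarith [pow_nonneg (abs_nonneg z) n]

theorem summable_sternB {z : ℝ} (hz : |z| < 1) :
    Summable fun n : ℕ => (twistedSternSeq (n + 1) : ℝ) * z ^ n := by
  have h := (summable_pow_mul_geometric_of_norm_lt_one 1 (r := |z|) (by simpa using hz)).add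
    (summable_geometric_of_lt_one (abs_nonneg z) hz)
  refine Summable.of_norm_bounded h fun n => ?_
  have h1 : |(twistedSternSeq (n + 1) : ℝ)| ≤ n + 1 := by
    exact_mod_cast (abs_sternSeq_le (n + 1)).2
  rw [norm_mul, norm_pow, Real.norm_eq_abs, Real.norm_eq_abs]
  nlinarith [pow_nonneg (abs_nonneg z) n]

theorem summable_abs_pow_pow {d : ℕ} (hd : 2 ≤ d) {z : ℝ} (hz : |z| < 1) :
    Summable fun k : ℕ => |z| ^ (d ^ k) :=
  Summable.of_nonneg_of_le (fun _ => by positivity)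
    (fun k => pow_le_pow_of_le_one (abs_nonneg z) hz.le (Nat.lt_pow_self (by omega)).le)
    (summable_geometric_of_lt_one (abs_nonneg z) hz)

theorem multipliable_thueMorseT {z : ℝ} (hz : |z| < 1) :
    Multipliable fun j : ℕ => 1 - z ^ (2 ^ j) := by
  simp only [sub_eq_add_neg]
  exact multipliable_one_add_of_summable
    (by simpa [norm_neg, norm_pow] using summable_abs_pow_pow le_rfl hz)

theorem abs_pow_pow_le {d : ℕ} (hd : 1 ≤ d) {z : ℝ} (hz : |z| < 1) (k : ℕ) :
    |z ^ (d ^ k)| ≤ |z| := by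
  rw [abs_pow]
  exact pow_le_of_le_one (abs_nonneg z) hz.le (by positivity)

theorem summable_thueMorseM {z : ℝ} (hz : |z| < 1) :
    Summable fun j : ℕ =>
      (-1) ^ j * z ^ (2 ^ j) / ∏ i ∈ Finset.range j, (1 - z ^ (2 ^ i)) := by
  have hne : ∀ i : ℕ, 1 - z ^ (2 ^ i) ≠ 0 := fun i h => by
    have h1 := (le_abs_self _).trans (abs_pow_pow_le (d := 2) (by norm_num) hz i)
    linarith
  rcases eq_or_ne z 0 with rfl | h0
  · simp
  refine summable_of_ratio_test_tendsto_lt_one (l := 0) one_pos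
    (Filter.Eventually.of_forall fun j => ?_) ?_
  · exact div_ne_zero (mul_ne_zero (by simp) (pow_ne_zero _ h0))
      (Finset.prod_ne_zero_iff.2 fun i _ => hne i)
  · have hlim : Filter.Tendsto (fun j : ℕ => z ^ (2 ^ j)) Filter.atTop (nhds 0) :=
      (tendsto_pow_atTop_nhds_zero_of_abs_lt_one hz).comp
        (tendsto_pow_atTop_atTop_of_one_lt (by norm_num))
    have h2 := (hlim.div (hlim.const_sub 1) (by norm_num)).norm
    simp only [zero_div, norm_zero] at h2
    refine h2.congr fun j => ?_
    rw [← norm_div, ← norm_neg]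
    congr 1
    have hp : ∏ i ∈ Finset.range j, (1 - z ^ (2 ^ i)) ≠ 0 :=
      Finset.prod_ne_zero_iff.2 fun i _ => hne i
    have hj := hne j
    rw [Finset.prod_range_succ, pow_succ 2 j, pow_mul, pow_succ (-1 : ℝ) j]
    have hz' : z ^ 2 ^ j ≠ 0 := pow_ne_zero _ h0
    have hs : (-1 : ℝ) ^ j ≠ 0 := by simp
    simp only [Pi.div_apply]
    field_simp

theorem summable_lambert {d : ℕ} (hd : 2 ≤ d) {z : ℝ} (hz : |z| < 1) :
    (Summable fun k : ℕ => z ^ (d ^ k) / (1 - z ^ (d ^ k))) ∧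
      Summable fun k : ℕ => z ^ (d ^ k) / (1 + z ^ (d ^ k)) := by
  have h := (summable_abs_pow_pow hd hz).div_const (1 - |z|)
  have hz' : 0 < 1 - |z| := by linarith
  constructor <;> refine Summable.of_norm_bounded h fun k => ?_ <;>
    have hk := abs_le.1 (abs_pow_pow_le (d := d) (by omega) hz k)
  · rw [norm_div, norm_pow, Real.norm_eq_abs, Real.norm_eq_abs]
    gcongr
    exact le_trans (by linarith) (le_abs_self _)
  · rw [norm_div, norm_pow, Real.norm_eq_abs, Real.norm_eq_abs]
    gcongr
    exact le_trans (by linarith) (le_abs_self _)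

end Convergence

/-! Each function satisfies a Mahler equation linking its values at `z` and `z ^ d`. Iterated at `z
= 1 / b`, it writes both numbers of a pair as `α = u + w * f x` with the same `x = b ^ (-s d ^ k)`
and explicit `u`, `w` of controlled denominator. Take a Hermite–Padé approximant: polynomials `q`,
`p₁`, `p₂` with `q f_i - p_i = O(x ^ m)`. The triple `q`, `u₁ q + w₁ p₁`, `u₂ q + w₂ p₂` at `x`,
times a common denominator, is an integer triple nearly proportional to `(1, α₁, α₂)`: its first
entry has order at most `b ^ (E d ^ k)` and its errors have order at most `b ^ (-ρ d ^ k)`, where `E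
+ ρ = s m`. Three approximants with nonzero determinant give three independent triples for all large
`k` (`approxForms_of_levels`).

A nonzero integer vector of height `X` has a nonzero integer product with one of the three triples.
Once the errors are at most `1 / (4 X)`, this bounds the linear form below by `1 / (2 Q)`, where `Q`
bounds the first entries (`one_le_mul_linForm`). The first accurate enough triple has `Q ≪ X ^ μ`
provided each size exponent is at most `μ` times the preceding error exponent
(`linIndepExponent_le_of_approxForms`). For the Thue–Morse and Lambert pairs one approximant per
level suffices. For the Stern pair the gap between levels is too large, and four tables are
interleaved to reach 3.

What remains is finite computation on integer lists. A list is certified as the start of an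
expansion by checking the Mahler equation modulo `y ^ m` (`approxL_of_functional_eq`). -/

/-! ### Computable polynomials as integer lists -/

/-- The value at `y` of the polynomial with coefficient list `l`, constant term first. -/
def evalL : List ℤ → ℝ → ℝ
  | [], _ => 0
  | a :: l, y => a + y * evalL l y

/-- Coefficientwise sum. -/
def addL : List ℤ → List ℤ → List ℤ
  | [], m => m
  | a :: l, [] => a :: l
  | a :: l, b :: m => (a + b) :: addL l m

/-- Multiplication by a constant. -/
def smulL (c : ℤ) : List ℤ → List ℤ
  | [] => []
  | a :: l => (c * a) :: smulL c l

/-- Product of polynomials. -/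
def mulL : List ℤ → List ℤ → List ℤ
  | [], _ => []
  | a :: l, m => addL (smulL a m) (0 :: mulL l m)

/-- Difference of polynomials. -/
def subL (l m : List ℤ) : List ℤ := addL l (smulL (-1) m)

/-- The polynomial `y ^ n * l`. -/
def shiftL : ℕ → List ℤ → List ℤ
  | 0, l => l
  | n + 1, l => 0 :: shiftL n l

/-- The polynomial `l (y ^ (n + 1))`. -/
def expandL (n : ℕ) : List ℤ → List ℤ
  | [] => []
  | a :: l => a :: shiftL n (expandL n l)

/-- The first `n` coefficients vanish. -/
def vanishL : ℕ → List ℤ → Bool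
  | 0, _ => true
  | _ + 1, [] => true
  | n + 1, a :: l => decide (a = 0) && vanishL n l

/-- Some coefficient is nonzero. -/
def nonzeroL : List ℤ → Bool
  | [] => false
  | a :: l => !decide (a = 0) || nonzeroL l

theorem evalL_addL (l m : List ℤ) (y : ℝ) : evalL (addL l m) y = evalL l y + evalL m y := by
  induction l generalizing m with
  | nil => simp [addL, evalL]
  | cons a l ih =>
    cases m with
    | nil => simp [addL, evalL]
    | cons b m => simp only [addL, evalL, ih]; push_cast; ring

theorem evalL_smulL (c : ℤ) (l : List ℤ) (y : ℝ) : evalL (smulL c l) y = c * evalL l y := by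
  induction l with
  | nil => simp [smulL, evalL]
  | cons a l ih => simp only [smulL, evalL, ih]; push_cast; ring

theorem evalL_mulL (l m : List ℤ) (y : ℝ) : evalL (mulL l m) y = evalL l y * evalL m y := by
  induction l with
  | nil => simp [mulL, evalL]
  | cons a l ih => simp only [mulL, evalL, evalL_addL, evalL_smulL, ih]; push_cast; ring

theorem evalL_subL (l m : List ℤ) (y : ℝ) : evalL (subL l m) y = evalL l y - evalL m y := by
  simp only [subL, evalL_addL, evalL_smulL]; push_cast; ring

theorem evalL_shiftL (n : ℕ) (l : List ℤ) (y : ℝ) : evalL (shiftL n l) y = y ^ n * evalL l y := by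
  induction n with
  | zero => simp [shiftL]
  | succ n ih => simp only [shiftL, evalL, ih, pow_succ]; push_cast; ring

theorem evalL_expandL (n : ℕ) (l : List ℤ) (y : ℝ) :
    evalL (expandL n l) y = evalL l (y ^ (n + 1)) := by
  induction l with
  | nil => simp [expandL, evalL]
  | cons a l ih => simp only [expandL, evalL, evalL_shiftL, ih, pow_succ]; ring

theorem evalL_take_add_drop (n : ℕ) (l : List ℤ) (y : ℝ) :
    evalL l y = evalL (l.take n) y + y ^ n * evalL (l.drop n) y := by
  induction n generalizing l with
  | zero => simp [evalL]
  | succ n ih =>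
    cases l with
    | nil => simp [evalL]
    | cons a l =>
      simp only [List.take_succ_cons, List.drop_succ_cons, evalL]
      rw [ih l, pow_succ]; ring

theorem exists_abs_evalL_le (l : List ℤ) :
    ∃ C : ℝ, 0 ≤ C ∧ ∀ y : ℝ, 0 ≤ y → y ≤ 1 → |evalL l y| ≤ C := by
  induction l with
  | nil => exact ⟨0, le_rfl, by simp [evalL]⟩
  | cons a l ih =>
    obtain ⟨C, hC, h⟩ := ih
    refine ⟨|(a : ℝ)| + C, by positivity, fun y h0 h1 => (abs_add_le _ _).trans ?_⟩
    rw [abs_mul, abs_of_nonneg h0]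
    have := h y h0 h1
    have := abs_nonneg (evalL l y)
    nlinarith

theorem exists_abs_evalL_le_pow {n : ℕ} {l : List ℤ} (hl : vanishL n l = true) :
    ∃ C : ℝ, 0 ≤ C ∧ ∀ y : ℝ, 0 ≤ y → y ≤ 1 → |evalL l y| ≤ C * y ^ n := by
  induction n generalizing l with
  | zero => simpa using exists_abs_evalL_le l
  | succ n ih =>
    cases l with
    | nil => exact ⟨0, le_rfl, by simp [evalL]⟩
    | cons a l =>
      simp only [vanishL, Bool.and_eq_true, decide_eq_true_eq] at hl
      obtain ⟨C, hC, h⟩ := ih hl.2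
      refine ⟨C, hC, fun y h0 h1 => ?_⟩
      simp only [evalL, hl.1, Int.cast_zero, zero_add, abs_mul, abs_of_nonneg h0, pow_succ]
      nlinarith [h y h0 h1]

theorem continuous_evalL (l : List ℤ) : Continuous (evalL l) := by
  induction l with
  | nil => exact continuous_const
  | cons a l ih => exact continuous_const.add (continuous_id.mul ih)

/-- Factor out the largest power of `y`, nonzero for `y > 0`; the cofactor is continuous with
nonzero constant term. -/
theorem eventually_evalL_ne_zero {l : List ℤ} (hl : nonzeroL l = true) :
    ∀ᶠ y in nhdsWithin (0 : ℝ) (Set.Ioi 0), evalL l y ≠ 0 := by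
  induction l with
  | nil => simp [nonzeroL] at hl
  | cons a l ih =>
    by_cases ha : a = 0
    · have h := ih (by simpa [nonzeroL, ha] using hl)
      filter_upwards [h, self_mem_nhdsWithin] with y hy h0
      simp only [evalL, ha, Int.cast_zero, zero_add]
      exact mul_ne_zero (ne_of_gt h0) hy
    · refine nhdsWithin_le_nhds ?_
      refine (continuous_evalL (a :: l)).continuousAt.eventually_ne ?_
      simpa [evalL] using ha

/-- Determinant of a `3 × 3` matrix of polynomials. -/
def detL (r s t : List ℤ × List ℤ × List ℤ) : List ℤ :=
  addL (subL (mulL r.1 (subL (mulL s.2.1 t.2.2) (mulL s.2.2 t.2.1)))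
    (mulL r.2.1 (subL (mulL s.1 t.2.2) (mulL s.2.2 t.1))))
    (mulL r.2.2 (subL (mulL s.1 t.2.1) (mulL s.2.1 t.1)))

theorem evalL_detL (r s t : List ℤ × List ℤ × List ℤ) (y : ℝ) :
    evalL (detL r s t) y =
      evalL r.1 y * (evalL s.2.1 y * evalL t.2.2 y - evalL s.2.2 y * evalL t.2.1 y) -
      evalL r.2.1 y * (evalL s.1 y * evalL t.2.2 y - evalL s.2.2 y * evalL t.1 y) +
      evalL r.2.2 y * (evalL s.1 y * evalL t.2.1 y - evalL s.2.1 y * evalL t.1 y) := by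
  simp only [detL, evalL_addL, evalL_subL, evalL_mulL]

/-! ### Mahler equations and Hermite–Padé remainders -/

/-- The function `f` agrees with the polynomial `L` up to `O(y ^ m)` on `(0, 1/2]`. -/
def ApproxL (f : ℝ → ℝ) (L : List ℤ) (m : ℕ) : Prop :=
  ∃ C : ℝ, 0 ≤ C ∧ ∀ y : ℝ, 0 < y → y ≤ 1 / 2 → |f y - evalL L y| ≤ C * y ^ m

/-- A polynomial that satisfies a Mahler equation modulo `y ^ m` and has the right value at `0`
approximates the solution to order `m`. -/
theorem approxL_of_functional_eq {f : ℝ → ℝ} {d m : ℕ} {D U W L : List ℤ} {a : ℤ} (hd : 1 ≤ d)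
    (hD : ∀ y : ℝ, 0 < y → y ≤ 1 / 2 → 1 / 2 ≤ evalL D y)
    (hf : ∀ y : ℝ, 0 < y → y ≤ 1 / 2 →
      evalL D y * f y = evalL U y + evalL W y * f (y ^ (d + 1)))
    (h0 : ∃ C : ℝ, ∀ y : ℝ, 0 < y → y ≤ 1 / 2 → |f y - a| ≤ C * y)
    (hL : vanishL m (subL (mulL D (a :: L)) (addL U (mulL W (expandL d (a :: L))))) = true) :
    ApproxL f (a :: L) m := by
  obtain ⟨E, hE, hEy⟩ := exists_abs_evalL_le_pow hL
  obtain ⟨V, hV, hVy⟩ := exists_abs_evalL_le W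
  -- Substituting `y ^ (d + 1)` multiplies the order of agreement by `d + 1 ≥ 2`, so each use of the
  -- equation gains at least one order until `m` is reached. Dividing by `D ≥ 1 / 2` costs only a
  -- factor 2.
  have key : ∀ s : ℕ, ApproxL f (a :: L) (min (s + 1) m) := by
    intro s
    induction s with
    | zero =>
      obtain ⟨C, hC⟩ := h0
      obtain ⟨B, hB, hBy⟩ := exists_abs_evalL_le L
      refine ⟨|C| + B, by positivity, fun y hy hy' => ?_⟩
      have h1 := hC y hy hy'
      have h2 := hBy y hy.le (by linarith)
      have h3 : |f y - evalL (a :: L) y| ≤ (|C| + B) * y := by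
        have : f y - evalL (a :: L) y = (f y - a) - y * evalL L y := by simp only [evalL]; ring
        rw [this]
        refine (abs_sub _ _).trans ?_
        rw [abs_mul, abs_of_pos hy]
        nlinarith [le_abs_self C]
      refine h3.trans ?_
      have : y ^ 1 ≤ y ^ min (0 + 1) m :=
        pow_le_pow_of_le_one hy.le (by linarith) (by omega)
      rw [pow_one] at this
      gcongr
    | succ s ih =>
      obtain ⟨C, hC, hCy⟩ := ih
      refine ⟨2 * (E + V * C), by positivity, fun y hy hy' => ?_⟩
      have hyd : y ^ (d + 1) ≤ 1 / 2 :=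
        (pow_le_of_le_one hy.le (by linarith) (by omega)).trans hy'
      have h1 := hCy (y ^ (d + 1)) (by positivity) hyd
      have h2 := hEy y hy.le (by linarith)
      have h3 := hVy y hy.le (by linarith)
      have h4 := hD y hy hy'
      simp only [evalL_subL, evalL_mulL, evalL_addL, evalL_expandL] at h2
      have h5 : evalL D y * (f y - evalL (a :: L) y) =
          evalL W y * (f (y ^ (d + 1)) - evalL (a :: L) (y ^ (d + 1))) -
          (evalL D y * evalL (a :: L) y -
            (evalL U y + evalL W y * evalL (a :: L) (y ^ (d + 1)))) := by
        rw [mul_sub, hf y hy hy']; ring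
      have h6 : (y ^ (d + 1)) ^ min (s + 1) m ≤ y ^ min (s + 1 + 1) m := by
        rw [← pow_mul]
        refine pow_le_pow_of_le_one hy.le (by linarith) ?_
        have : 2 * min (s + 1) m ≤ (d + 1) * min (s + 1) m := by gcongr; omega
        omega
      have h7 : y ^ m ≤ y ^ min (s + 1 + 1) m :=
        pow_le_pow_of_le_one hy.le (by linarith) (by omega)
      have h8 : |evalL D y * (f y - evalL (a :: L) y)| ≤
          (E + V * C) * y ^ min (s + 1 + 1) m := by
        rw [h5]
        refine (abs_sub _ _).trans ?_
        rw [abs_mul]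
        have h9 : |evalL W y| * |f (y ^ (d + 1)) - evalL (a :: L) (y ^ (d + 1))| ≤
            V * (C * y ^ min (s + 1 + 1) m) := by
          refine mul_le_mul h3 (h1.trans ?_) (abs_nonneg _) hV
          gcongr
        have h10 : E * y ^ m ≤ E * y ^ min (s + 1 + 1) m := by gcongr
        linarith
      rw [abs_mul, abs_of_pos (by linarith : (0 : ℝ) < evalL D y)] at h8
      nlinarith [abs_nonneg (f y - evalL (a :: L) y)]
  simpa using key m

/-- The Hermite–Padé remainder `q f - p`, where `p` is the truncation of `q L` to its first `n`
coefficients. -/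
theorem exists_abs_remainder_le {f : ℝ → ℝ} {L q : List ℤ} {m n r : ℕ} (hf : ApproxL f L m)
    (hn : n + r = m) (hq : vanishL r ((mulL q L).drop n) = true) :
    ∃ C : ℝ, 0 ≤ C ∧ ∀ y : ℝ, 0 < y → y ≤ 1 / 2 →
      |evalL q y * f y - evalL ((mulL q L).take n) y| ≤ C * y ^ m := by
  obtain ⟨C, hC, hCy⟩ := hf
  obtain ⟨E, hE, hEy⟩ := exists_abs_evalL_le_pow hq
  obtain ⟨V, hV, hVy⟩ := exists_abs_evalL_le q
  refine ⟨V * C + E, by positivity, fun y hy hy' => ?_⟩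
  have h1 := hCy y hy hy'
  have h2 := hEy y hy.le (by linarith)
  have h3 := hVy y hy.le (by linarith)
  -- Two sources of error: replacing `f` by `L`, and the discarded tail of `q L`. The tail starts at
  -- `y ^ n` and its first `r` coefficients vanish, hence order `n + r = m`.
  have h4 : evalL q y * f y - evalL ((mulL q L).take n) y =
      evalL q y * (f y - evalL L y) + y ^ n * evalL ((mulL q L).drop n) y := by
    have := evalL_take_add_drop n (mulL q L) y
    rw [evalL_mulL] at this
    linarith
  rw [h4]
  refine (abs_add_le _ _).trans ?_
  rw [abs_mul, abs_mul, abs_of_pos (pow_pos hy n)]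
  have h5 : |evalL q y| * |f y - evalL L y| ≤ V * (C * y ^ m) :=
    mul_le_mul h3 h1 (abs_nonneg _) hV
  have h6 : y ^ n * |evalL ((mulL q L).drop n) y| ≤ y ^ n * (E * y ^ r) := by gcongr
  rw [← hn, pow_add] at *
  linarith

/-! ### From independent approximations to the exponent -/

theorem tripleHeight_abs_le (h : Fin 3 → ℤ) (i : Fin 3) : |h i| ≤ tripleHeight h := by
  unfold tripleHeight
  fin_cases i <;> simp

theorem one_le_tripleHeight {h : Fin 3 → ℤ} (hh : h ≠ 0) : 1 ≤ tripleHeight h := by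
  obtain ⟨i, hi⟩ := Function.ne_iff.1 hh
  exact (Int.one_le_abs hi).trans (tripleHeight_abs_le h i)

theorem finite_tripleHeight_le (N : ℝ) : {h : Fin 3 → ℤ | (tripleHeight h : ℝ) ≤ N}.Finite := by
  refine (Set.finite_Icc (fun _ : Fin 3 => -⌊N⌋) (fun _ : Fin 3 => ⌊N⌋)).subset fun h hh => ?_
  have h1 : tripleHeight h ≤ ⌊N⌋ := Int.le_floor.2 hh
  exact ⟨fun i => (abs_le.1 ((tripleHeight_abs_le h i).trans h1)).1,
    fun i => (abs_le.1 ((tripleHeight_abs_le h i).trans h1)).2⟩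

/-- A linear form in `1, α₁, α₂` is bounded below by means of three linearly independent
simultaneous rational approximations. -/
theorem one_le_mul_linForm {α₁ α₂ Q X : ℝ} {W : Matrix (Fin 3) (Fin 3) ℤ} (hW : W.det ≠ 0)
    (hQ : ∀ i, |(W i 0 : ℝ)| ≤ Q) (h₁ : ∀ i, X * |W i 0 * α₁ - W i 1| ≤ 1 / 4)
    (h₂ : ∀ i, X * |W i 0 * α₂ - W i 2| ≤ 1 / 4) {h : Fin 3 → ℤ} (hh : h ≠ 0)
    (hX : tripleHeight h ≤ X) : 1 ≤ 2 * (Q * |h 0 + h 1 * α₁ + h 2 * α₂|) := by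
  -- Some row has a nonzero, hence at least 1 in absolute value, integer product with `h`. The two
  -- approximation errors account for at most `1 / 4` each, so the term containing the linear form
  -- is at least `1 / 2`.
  have hne : W.mulVec h ≠ 0 := fun h0 => hh (Matrix.eq_zero_of_mulVec_eq_zero hW h0)
  obtain ⟨i, hi⟩ := Function.ne_iff.1 hne
  have h3 : (1 : ℝ) ≤ |((W.mulVec h i : ℤ) : ℝ)| := by exact_mod_cast Int.one_le_abs hi
  have h4 : ((W.mulVec h i : ℤ) : ℝ) = W i 0 * (h 0 + h 1 * α₁ + h 2 * α₂) -
      h 1 * (W i 0 * α₁ - W i 1) - h 2 * (W i 0 * α₂ - W i 2) := by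
    simp only [Matrix.mulVec, dotProduct, Fin.sum_univ_three]; push_cast; ring
  have hb : ∀ j, |(h j : ℝ)| ≤ X := fun j =>
    le_trans (by exact_mod_cast tripleHeight_abs_le h j) hX
  have h5 : |(h 1 : ℝ) * (W i 0 * α₁ - W i 1)| ≤ 1 / 4 := by
    rw [abs_mul]
    exact (mul_le_mul_of_nonneg_right (hb 1) (abs_nonneg _)).trans (h₁ i)
  have h6 : |(h 2 : ℝ) * (W i 0 * α₂ - W i 2)| ≤ 1 / 4 := by
    rw [abs_mul]
    exact (mul_le_mul_of_nonneg_right (hb 2) (abs_nonneg _)).trans (h₂ i)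
  have h7 : |(W i 0 : ℝ) * (h 0 + h 1 * α₁ + h 2 * α₂)| ≤ Q * |h 0 + h 1 * α₁ + h 2 * α₂| := by
    rw [abs_mul]
    exact mul_le_mul_of_nonneg_right (hQ i) (abs_nonneg _)
  rw [h4] at h3
  have h8 := abs_sub ((W i 0 : ℝ) * (h 0 + h 1 * α₁ + h 2 * α₂) -
    h 1 * (W i 0 * α₁ - W i 1)) (h 2 * (W i 0 * α₂ - W i 2))
  have h9 := abs_sub ((W i 0 : ℝ) * (h 0 + h 1 * α₁ + h 2 * α₂)) (h 1 * (W i 0 * α₁ - W i 1))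
  linarith

/-- Take `X` equal to the height `H` of a solution for some `ν > μ`. Then `1 ≤ 2 C H ^ μ |Λ| < 2 C H
^ (μ - ν)`, which fails for large `H`; only finitely many triples have bounded height. -/
theorem linIndepExponent_le_of_eventually {α₁ α₂ C : ℝ} {μ : ℕ}
    (H : ∀ᶠ X : ℝ in Filter.atTop, ∃ W : Matrix (Fin 3) (Fin 3) ℤ, W.det ≠ 0 ∧
      (∀ i, |(W i 0 : ℝ)| ≤ C * X ^ μ) ∧ (∀ i, X * |W i 0 * α₁ - W i 1| ≤ 1 / 4) ∧
      ∀ i, X * |W i 0 * α₂ - W i 2| ≤ 1 / 4) :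
    linIndepExponent α₁ α₂ ≤ (μ : ℕ) := by
  refine sSup_le ?_
  rintro _ ⟨ν, rfl, hν⟩
  by_contra! hlt
  have hlt' : (μ : ℝ) < ν := by
    have : (((μ : ℕ) : ℝ) : EReal) < (ν : EReal) := by simpa using hlt
    exact_mod_cast this
  refine hν ?_
  have h1 : Filter.Tendsto (fun X : ℝ => X ^ (ν - μ)) Filter.atTop Filter.atTop :=
    tendsto_rpow_atTop (by linarith)
  obtain ⟨N, hN⟩ := Filter.eventually_atTop.1 (H.and (h1.eventually_ge_atTop (2 * C)))
  refine (finite_tripleHeight_le N).subset fun h hh => ?_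
  by_contra! hlarge
  simp only [Set.mem_ofPred_eq, not_le] at hlarge
  obtain ⟨⟨W, hdet, hQ, hW₁, hW₂⟩, hX⟩ := hN _ hlarge.le
  have hpos : (0 : ℝ) < tripleHeight h := by
    exact_mod_cast zero_lt_one.trans_le (one_le_tripleHeight hh.1)
  have h2 := one_le_mul_linForm hdet hQ hW₁ hW₂ hh.1 le_rfl
  have h3 := hh.2
  have hP : (0 : ℝ) < (tripleHeight h : ℝ) ^ μ := by positivity
  have hC : 0 < C := by
    by_contra! hC
    have : C * (tripleHeight h : ℝ) ^ μ ≤ 0 := mul_nonpos_of_nonpos_of_nonneg hC hP.le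
    nlinarith [abs_nonneg ((h 0 : ℝ) + h 1 * α₁ + h 2 * α₂)]
  have h4 : C * (tripleHeight h : ℝ) ^ μ * |(h 0 : ℝ) + h 1 * α₁ + h 2 * α₂| <
      C * (tripleHeight h : ℝ) ^ μ * (tripleHeight h : ℝ) ^ (-ν) :=
    mul_lt_mul_of_pos_left h3 (by positivity)
  have h5 : (tripleHeight h : ℝ) ^ μ * (tripleHeight h : ℝ) ^ (-ν) *
      (tripleHeight h : ℝ) ^ (ν - μ) = 1 := by
    rw [← Real.rpow_natCast, ← Real.rpow_add hpos, ← Real.rpow_add hpos]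
    rw [show (μ : ℝ) + -ν + (ν - μ) = 0 by ring, Real.rpow_zero]
  have h6 : (0 : ℝ) < (tripleHeight h : ℝ) ^ μ * (tripleHeight h : ℝ) ^ (-ν) := by positivity
  nlinarith

/-- At all large levels `k` there are three independent integer triples of size `b ^ (E d ^ k)`
approximating `(1, α₁, α₂)` with errors `b ^ (-ρ d ^ k)`. -/
def ApproxForms (b d : ℕ) (α₁ α₂ : ℝ) (E ρ : ℕ) : Prop :=
  ∃ C : ℝ, 0 < C ∧ ∀ᶠ k : ℕ in Filter.atTop, ∃ W : Matrix (Fin 3) (Fin 3) ℤ, W.det ≠ 0 ∧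
    (∀ i, |(W i 0 : ℝ)| ≤ C * b ^ (E * d ^ k)) ∧
    (∀ i, b ^ (ρ * d ^ k) * |W i 0 * α₁ - W i 1| ≤ C) ∧
    ∀ i, b ^ (ρ * d ^ k) * |W i 0 * α₂ - W i 2| ≤ C

/-- The `g` families are interleaved into one sequence, family `t % g` at level `t / g`. `hstep`
compares neighbours within a level, and `hwrap` compares the last family with the first one of the
next level, which brings the factor `d`. -/
theorem linIndepExponent_le_of_approxForms {b d g μ : ℕ} {α₁ α₂ : ℝ} {E ρ : ℕ → ℕ}
    (hb : 2 ≤ b) (hd : 2 ≤ d) (hg : 0 < g) (hρ : ∀ i < g, 0 < ρ i)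
    (hstep : ∀ i, i + 1 < g → E (i + 1) ≤ μ * ρ i) (hwrap : d * E 0 ≤ μ * ρ (g - 1))
    (H : ∀ i < g, ApproxForms b d α₁ α₂ (E i) (ρ i)) :
    linIndepExponent α₁ α₂ ≤ (μ : ℕ) := by
  have hb1 : (1 : ℝ) ≤ b := by exact_mod_cast (by omega : 1 ≤ b)
  choose C hC hW using fun i : Fin g => H i i.2
  obtain ⟨k₀, hk₀⟩ := Filter.eventually_atTop.1 (Filter.eventually_all.2 hW)
  set S : ℝ := ∑ i, C i with hS
  have hCS : ∀ i, C i ≤ S := fun i =>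
    Finset.single_le_sum (f := C) (fun j _ => (hC j).le) (Finset.mem_univ i)
  have hSpos : 0 < S := (hC ⟨0, hg⟩).trans_le (hCS _)
  set r : ℕ → ℕ := fun t => ρ (t % g) * d ^ (t / g) with hr
  have hrE : ∀ t, E ((t + 1) % g) * d ^ ((t + 1) / g) ≤ μ * r t := by
    intro t
    have h1 := Nat.div_add_mod t g
    have h2 := Nat.mod_lt t hg
    rcases Nat.lt_or_ge (t % g + 1) g with h | h
    · have h3 : (t + 1) / g = t / g ∧ (t + 1) % g = t % g + 1 :=
        (Nat.div_mod_unique hg).2 ⟨by omega, h⟩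
      rw [h3.1, h3.2, hr]
      nlinarith [hstep _ h, Nat.pos_of_ne_zero (pow_ne_zero (t / g) (by omega : d ≠ 0))]
    · have h3 : (t + 1) / g = t / g + 1 ∧ (t + 1) % g = 0 :=
        (Nat.div_mod_unique hg).2 ⟨by rw [mul_add]; omega, hg⟩
      have h4 : t % g = g - 1 := by omega
      simp only [h3.1, h3.2, hr, h4, pow_succ]
      nlinarith [hwrap, Nat.pos_of_ne_zero (pow_ne_zero (t / g) (by omega : d ≠ 0))]
  have hrt : Filter.Tendsto r Filter.atTop Filter.atTop := by
    have h1 : Filter.Tendsto (fun t => d ^ (t / g)) Filter.atTop Filter.atTop :=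
      (tendsto_pow_atTop_atTop_of_one_lt (by omega : 1 < d)).comp
        (Nat.tendsto_div_const_atTop hg.ne')
    exact Filter.tendsto_atTop_mono
      (fun t => Nat.le_mul_of_pos_left _ (hρ _ (Nat.mod_lt _ hg))) h1
  have hbt : Filter.Tendsto (fun t => (b : ℝ) ^ r t) Filter.atTop Filter.atTop :=
    (tendsto_pow_atTop_atTop_of_one_lt (by exact_mod_cast (by omega : 1 < b))).comp hrt
  refine linIndepExponent_le_of_eventually (C := S * (4 * S) ^ μ) ?_
  obtain ⟨t₀, ht₀⟩ : ∃ t₀, ∀ t, t₀ ≤ t → k₀ ≤ t / g :=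
    Filter.eventually_atTop.1
      ((Nat.tendsto_div_const_atTop hg.ne').eventually_ge_atTop k₀)
  -- Once `4 S X` exceeds every `b ^ r t` with `t ≤ t₀`, the index found below lies beyond `t₀`,
  -- where the approximations exist.
  set B : ℝ := ∑ t ∈ Finset.range (t₀ + 1), (b : ℝ) ^ r t with hB
  filter_upwards [Filter.eventually_gt_atTop (B / (4 * S)), Filter.eventually_ge_atTop 0]
    with X hX hX0
  have hX' : B < 4 * S * X := by rwa [div_lt_iff₀' (by positivity)] at hX
  have hex : ∃ t, 4 * S * X ≤ (b : ℝ) ^ r t := (hbt.eventually_ge_atTop _).exists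
  classical
  set t := Nat.find hex with ht
  have h1 : 4 * S * X ≤ (b : ℝ) ^ r t := Nat.find_spec hex
  have h2 : t₀ + 1 ≤ t := by
    by_contra! h
    have : (b : ℝ) ^ r t ≤ B :=
      Finset.single_le_sum (f := fun t => (b : ℝ) ^ r t) (fun j _ => by positivity)
        (Finset.mem_range.2 h)
    linarith
  obtain ⟨s, hs⟩ := Nat.exists_eq_add_of_le' (by omega : 1 ≤ t)
  -- The predecessor of the least sufficient index is not accurate enough; this inequality is what
  -- converts the size of the triple into a power of `X`.
  have h3 : (b : ℝ) ^ r s < 4 * S * X := not_le.1 (Nat.find_min hex (by omega))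
  have hi := Nat.mod_lt t hg
  obtain ⟨W, hdet, hQ, hW₁, hW₂⟩ := hk₀ (t / g) (ht₀ t (by omega)) ⟨t % g, hi⟩
  have hsmall : ∀ e : ℝ, 0 ≤ e → (b : ℝ) ^ r t * e ≤ C ⟨t % g, hi⟩ → X * e ≤ 1 / 4 := by
    intro e he hle
    have h4 : 4 * S * X * e ≤ S :=
      (mul_le_mul_of_nonneg_right h1 he).trans (hle.trans (hCS _))
    by_contra! h5
    nlinarith
  refine ⟨W, hdet, fun i => (hQ i).trans ?_, fun i => hsmall _ (abs_nonneg _) (hW₁ i),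
    fun i => hsmall _ (abs_nonneg _) (hW₂ i)⟩
  have h4 : (b : ℝ) ^ (E (t % g) * d ^ (t / g)) ≤ (4 * S) ^ μ * X ^ μ := by
    have h5 := hrE s
    rw [← hs] at h5
    calc (b : ℝ) ^ (E (t % g) * d ^ (t / g)) ≤ (b : ℝ) ^ (μ * r s) :=
          pow_le_pow_right₀ hb1 h5
      _ = ((b : ℝ) ^ r s) ^ μ := by rw [mul_comm, pow_mul]
      _ ≤ (4 * S * X) ^ μ := by gcongr
      _ = _ := by rw [mul_pow]
  calc C ⟨t % g, hi⟩ * (b : ℝ) ^ (E (t % g) * d ^ (t / g))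
      ≤ S * ((4 * S) ^ μ * X ^ μ) := by gcongr; exact hCS _
    _ = _ := by ring

/-! ### Clearing denominators at level `k` -/

/-- The integers, as a subring of the reals. -/
noncomputable abbrev intRange : Subring ℝ := (Int.castRingHom ℝ).range

theorem natCast_pow_mem_intRange (b n : ℕ) : (b : ℝ) ^ n ∈ intRange :=
  pow_mem (natCast_mem _ _) _

theorem pow_mul_mem_intRange_of_le {b m n : ℕ} {r : ℝ} (h : (b : ℝ) ^ m * r ∈ intRange)
    (hmn : m ≤ n) : (b : ℝ) ^ n * r ∈ intRange := by
  obtain ⟨k, rfl⟩ := Nat.exists_eq_add_of_le hmn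
  rw [add_comm, pow_add, mul_assoc]
  exact mul_mem (natCast_pow_mem_intRange _ _) h

theorem pow_mul_one_div_pow {b : ℕ} (hb : b ≠ 0) (n : ℕ) :
    (b : ℝ) ^ n * (1 / (b : ℝ)) ^ n = 1 := by
  have hb' : (b : ℝ) ≠ 0 := by exact_mod_cast hb
  rw [← mul_pow, mul_one_div_cancel hb', one_pow]

theorem pow_mul_evalL_mem_intRange {b N : ℕ} (hb : b ≠ 0) (l : List ℤ) (n : ℕ)
    (hl : l.length ≤ n + 1) : (b : ℝ) ^ (N * n) * evalL l ((1 / (b : ℝ)) ^ N) ∈ intRange := by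
  induction l generalizing n with
  | nil => simp [evalL]
  | cons a l ih =>
    have ha : (a : ℝ) ∈ intRange := intCast_mem _ _
    cases n with
    | zero =>
      have : l = [] := List.length_eq_zero_iff.1 (by simpa using hl)
      simp [this, evalL]
    | succ n =>
      have h := ih n (by simpa using hl)
      have : (b : ℝ) ^ (N * (n + 1)) * evalL (a :: l) ((1 / (b : ℝ)) ^ N) =
          (b : ℝ) ^ (N * (n + 1)) * a + (b : ℝ) ^ (N * n) * evalL l ((1 / (b : ℝ)) ^ N) := by
        simp only [evalL]
        rw [mul_add, mul_add N n 1, mul_one, pow_add]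
        linear_combination (b : ℝ) ^ (N * n) * evalL l ((1 / (b : ℝ)) ^ N) *
          pow_mul_one_div_pow hb N
      rw [this]
      exact add_mem (mul_mem (natCast_pow_mem_intRange _ _) ha) h

/-- Common denominators `D k`, integral up to the factor `b ^ (a d ^ k)`. -/
structure LevelDenominator (b d : ℕ) (D : ℕ → ℝ) (a : ℕ) : Prop where
  ne_zero : ∀ k, D k ≠ 0
  bounded : ∃ C, ∀ k, |D k| ≤ C
  integral : ∀ k, (b : ℝ) ^ (a * d ^ k) * D k ∈ intRange

/-- The number `α` is expressed through `f (b ^ (-s d ^ k))` by iterating a Mahler equation. -/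
structure LevelExpansion (b d s : ℕ) (α : ℝ) (f : ℝ → ℝ) (D u w : ℕ → ℝ) (c e : ℕ) : Prop where
  eq : ∀ k, α = u k + w k * f ((1 / (b : ℝ)) ^ (s * d ^ k))
  ne_zero : ∀ k, w k ≠ 0
  bounded : ∃ C, ∀ k, |D k * w k| ≤ C
  integral_u : ∀ k, (b : ℝ) ^ (c * d ^ k) * (D k * u k) ∈ intRange
  integral_w : ∀ k, (b : ℝ) ^ (e * d ^ k) * (D k * w k) ∈ intRange

section Levels

variable {b d s c e : ℕ} {α : ℝ} {f : ℝ → ℝ} {D u w : ℕ → ℝ}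

theorem one_div_pow_mem (hb : 2 ≤ b) {n : ℕ} (hn : 1 ≤ n) :
    0 < (1 / (b : ℝ)) ^ n ∧ (1 / (b : ℝ)) ^ n ≤ 1 / 2 := by
  have hb' : (2 : ℝ) ≤ b := by exact_mod_cast hb
  have h1 : 1 / (b : ℝ) ≤ 1 / 2 := one_div_le_one_div_of_le (by norm_num) hb'
  refine ⟨by positivity, (pow_le_of_le_one (by positivity) ?_ (by omega)).trans h1⟩
  linarith

theorem LevelDenominator.form_mem_intRange {a n E : ℕ} (hD : LevelDenominator b d D a)
    (hb : 2 ≤ b) (k : ℕ) {q : List ℤ} (hq : q.length ≤ n + 1) (hE : a + s * n ≤ E) :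
    (b : ℝ) ^ (E * d ^ k) * (D k * evalL q ((1 / (b : ℝ)) ^ (s * d ^ k))) ∈ intRange := by
  have h1 := mul_mem (hD.integral k)
    (pow_mul_evalL_mem_intRange (N := s * d ^ k) (by omega : b ≠ 0) q n hq)
  refine pow_mul_mem_intRange_of_le (m := a * d ^ k + s * d ^ k * n) ?_ ?_
  · convert h1 using 1
    rw [pow_add]; ring
  · calc _ = (a + s * n) * d ^ k := by ring
      _ ≤ _ := by gcongr

theorem LevelExpansion.form_mem_intRange {n n' E : ℕ} (h : LevelExpansion b d s α f D u w c e)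
    (hb : 2 ≤ b) (k : ℕ) {q p : List ℤ} (hq : q.length ≤ n + 1) (hp : p.length ≤ n' + 1)
    (hE : c + s * n ≤ E) (hE' : e + s * n' ≤ E) :
    (b : ℝ) ^ (E * d ^ k) * (D k * (u k * evalL q ((1 / (b : ℝ)) ^ (s * d ^ k)) +
      w k * evalL p ((1 / (b : ℝ)) ^ (s * d ^ k)))) ∈ intRange := by
  have h1 := mul_mem (h.integral_u k)
    (pow_mul_evalL_mem_intRange (N := s * d ^ k) (by omega : b ≠ 0) q n hq)
  have h2 := mul_mem (h.integral_w k)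
    (pow_mul_evalL_mem_intRange (N := s * d ^ k) (by omega : b ≠ 0) p n' hp)
  have h3 : (b : ℝ) ^ (E * d ^ k) *
      (D k * u k * evalL q ((1 / (b : ℝ)) ^ (s * d ^ k))) ∈ intRange := by
    refine pow_mul_mem_intRange_of_le (m := c * d ^ k + s * d ^ k * n) ?_ ?_
    · convert h1 using 1
      rw [pow_add]; ring
    · calc _ = (c + s * n) * d ^ k := by ring
        _ ≤ _ := by gcongr
  have h4 : (b : ℝ) ^ (E * d ^ k) *
      (D k * w k * evalL p ((1 / (b : ℝ)) ^ (s * d ^ k))) ∈ intRange := by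
    refine pow_mul_mem_intRange_of_le (m := e * d ^ k + s * d ^ k * n') ?_ ?_
    · convert h2 using 1
      rw [pow_add]; ring
    · calc _ = (e + s * n') * d ^ k := by ring
        _ ≤ _ := by gcongr
  convert add_mem h3 h4 using 1
  ring

/-- Since `α = u + w f(x)`, the terms `u q` cancel and the difference is `D w (q f - p)`, of order
`x ^ m = b ^ (-s m d ^ k)`. Of this, `b ^ (E d ^ k)` is spent on clearing denominators and `b ^ (ρ d
^ k)` is gained. -/
theorem LevelExpansion.exists_error_le {m n r E ρ : ℕ} {L q : List ℤ}
    (h : LevelExpansion b d s α f D u w c e) (hb : 2 ≤ b) (hd : 2 ≤ d) (hs : 1 ≤ s)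
    (hL : ApproxL f L m) (hn : n + r = m) (hq : vanishL r ((mulL q L).drop n) = true)
    (hE : E + ρ = s * m) :
    ∃ C : ℝ, 0 ≤ C ∧ ∀ k, (b : ℝ) ^ (ρ * d ^ k) *
      |(b : ℝ) ^ (E * d ^ k) * (D k * evalL q ((1 / (b : ℝ)) ^ (s * d ^ k))) * α -
        (b : ℝ) ^ (E * d ^ k) * (D k * (u k * evalL q ((1 / (b : ℝ)) ^ (s * d ^ k)) +
        w k * evalL ((mulL q L).take n) ((1 / (b : ℝ)) ^ (s * d ^ k))))| ≤ C := by
  obtain ⟨C, hC, hCy⟩ := exists_abs_remainder_le hL hn hq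
  obtain ⟨V, hV⟩ := h.bounded
  have hV0 : 0 ≤ V := (abs_nonneg _).trans (hV 0)
  refine ⟨V * C, by positivity, fun k => ?_⟩
  have hx := one_div_pow_mem hb (n := s * d ^ k)
    (Nat.mul_pos hs (Nat.pow_pos (by omega)))
  set x := (1 / (b : ℝ)) ^ (s * d ^ k) with hxdef
  have h1 := hCy x hx.1 hx.2
  have h2 : (b : ℝ) ^ (E * d ^ k) * (D k * evalL q x) * α -
      (b : ℝ) ^ (E * d ^ k) * (D k * (u k * evalL q x + w k * evalL ((mulL q L).take n) x)) =
      (b : ℝ) ^ (E * d ^ k) * ((D k * w k) *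
        (evalL q x * f x - evalL ((mulL q L).take n) x)) := by
    rw [h.eq k]; ring
  have h3 : (b : ℝ) ^ (ρ * d ^ k) * (b : ℝ) ^ (E * d ^ k) * x ^ m = 1 := by
    rw [hxdef, ← pow_add, ← pow_mul,
      show s * d ^ k * m = ρ * d ^ k + E * d ^ k by rw [← add_mul, add_comm ρ, hE]; ring]
    exact pow_mul_one_div_pow (by omega) _
  rw [h2, abs_mul, abs_mul, abs_of_nonneg (by positivity : (0 : ℝ) ≤ (b : ℝ) ^ (E * d ^ k))]
  have h4 : |D k * w k| * |evalL q x * f x - evalL ((mulL q L).take n) x| ≤ V * (C * x ^ m) :=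
    mul_le_mul (hV k) h1 (abs_nonneg _) hV0
  calc _ ≤ (b : ℝ) ^ (ρ * d ^ k) * ((b : ℝ) ^ (E * d ^ k) * (V * (C * x ^ m))) := by gcongr
    _ = V * C * ((b : ℝ) ^ (ρ * d ^ k) * (b : ℝ) ^ (E * d ^ k) * x ^ m) := by ring
    _ = V * C := by rw [h3, mul_one]

/-- Hermite–Padé triple with denominator `q` for two functions with expansions `L₁`, `L₂`. -/
def padeTriple (L₁ L₂ : List ℤ) (n₁ n₂ : ℕ) (q : List ℤ) : List ℤ × List ℤ × List ℤ :=
  (q, (mulL q L₁).take n₁, (mulL q L₂).take n₂)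

theorem tendsto_one_div_pow_level (hb : 2 ≤ b) (hd : 2 ≤ d) (hs : 1 ≤ s) :
    Filter.Tendsto (fun k => (1 / (b : ℝ)) ^ (s * d ^ k)) Filter.atTop
      (nhdsWithin 0 (Set.Ioi 0)) := by
  have hb' := one_div_pow_mem hb (le_refl 1)
  rw [pow_one] at hb'
  refine tendsto_nhdsWithin_iff.2 ⟨?_, Filter.Eventually.of_forall fun k => pow_pos hb'.1 _⟩
  refine (tendsto_pow_atTop_nhds_zero_of_lt_one hb'.1.le (by linarith)).comp ?_
  exact Filter.tendsto_atTop_mono (fun k => Nat.le_mul_of_pos_left _ hs)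
    (tendsto_pow_atTop_atTop_of_one_lt (by omega : 1 < d))

theorem approxForms_of_levels {a c₁ e₁ c₂ e₂ n n₁ n₂ r₁ r₂ m E ρ : ℕ} {α₁ α₂ : ℝ}
    {f₁ f₂ : ℝ → ℝ} {u₁ w₁ u₂ w₂ : ℕ → ℝ} {L₁ L₂ : List ℤ}
    (hD : LevelDenominator b d D a) (h₁ : LevelExpansion b d s α₁ f₁ D u₁ w₁ c₁ e₁)
    (h₂ : LevelExpansion b d s α₂ f₂ D u₂ w₂ c₂ e₂)
    (hL₁ : ApproxL f₁ L₁ m) (hL₂ : ApproxL f₂ L₂ m)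
    (hb : 2 ≤ b) (hd : 2 ≤ d) (hs : 1 ≤ s) (q : Fin 3 → List ℤ)
    (hq : ∀ i, (q i).length ≤ n + 1)
    (hv₁ : ∀ i, vanishL r₁ ((mulL (q i) L₁).drop (n₁ + 1)) = true)
    (hv₂ : ∀ i, vanishL r₂ ((mulL (q i) L₂).drop (n₂ + 1)) = true)
    (hdet : nonzeroL (detL (padeTriple L₁ L₂ (n₁ + 1) (n₂ + 1) (q 0))
      (padeTriple L₁ L₂ (n₁ + 1) (n₂ + 1) (q 1))
      (padeTriple L₁ L₂ (n₁ + 1) (n₂ + 1) (q 2))) = true)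
    (hr₁ : n₁ + 1 + r₁ = m) (hr₂ : n₂ + 1 + r₂ = m) (hE : E + ρ = s * m)
    (hEa : a + s * n ≤ E) (hEc₁ : c₁ + s * n ≤ E) (hEc₂ : c₂ + s * n ≤ E)
    (hEe₁ : e₁ + s * n₁ ≤ E) (hEe₂ : e₂ + s * n₂ ≤ E) :
    ApproxForms b d α₁ α₂ E ρ := by
  choose V hV0 hV using fun i => exists_abs_evalL_le (q i)
  choose A hA0 hA using fun i => h₁.exists_error_le hb hd hs hL₁ hr₁ (hv₁ i) hE
  choose B hB0 hB using fun i => h₂.exists_error_le hb hd hs hL₂ hr₂ (hv₂ i) hE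
  obtain ⟨M, hM⟩ := hD.bounded
  have hM0 : 0 ≤ M := (abs_nonneg _).trans (hM 0)
  have hle : ∀ (F : Fin 3 → ℝ), (∀ i, 0 ≤ F i) → ∀ i, F i ≤ ∑ j, F j := fun F hF i =>
    Finset.single_le_sum (f := F) (fun j _ => hF j) (Finset.mem_univ i)
  have hsV : 0 ≤ ∑ j, V j := Finset.sum_nonneg fun j _ => hV0 j
  have hsA : 0 ≤ ∑ j, A j := Finset.sum_nonneg fun j _ => hA0 j
  have hsB : 0 ≤ ∑ j, B j := Finset.sum_nonneg fun j _ => hB0 j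
  refine ⟨1 + M * ∑ j, V j + ∑ j, A j + ∑ j, B j, by positivity, ?_⟩
  filter_upwards [(tendsto_one_div_pow_level hb hd hs).eventually
    (eventually_evalL_ne_zero hdet)] with k hk
  have hx := one_div_pow_mem hb (n := s * d ^ k) (Nat.mul_pos hs (Nat.pow_pos (by omega)))
  choose W0 hW0 using fun i => hD.form_mem_intRange (s := s) (E := E) hb k (hq i) hEa
  choose W1 hW1 using fun i => h₁.form_mem_intRange (E := E) hb k (hq i)
    (List.length_take_le (n₁ + 1) (mulL (q i) L₁)) hEc₁ hEe₁
  choose W2 hW2 using fun i => h₂.form_mem_intRange (E := E) hb k (hq i)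
    (List.length_take_le (n₂ + 1) (mulL (q i) L₂)) hEc₂ hEe₂
  simp only [eq_intCast] at hW0 hW1 hW2
  have hb0 : (b : ℝ) ^ (E * d ^ k) ≠ 0 := pow_ne_zero _ (by positivity)
  refine ⟨Matrix.of fun i => ![W0 i, W1 i, W2 i], fun h0 => ?_, fun i => ?_, fun i => ?_,
    fun i => ?_⟩
  · have h0' := congrArg (Int.cast : ℤ → ℝ) h0
    rw [Matrix.det_fin_three] at h0'
    simp only [Matrix.of_apply, Matrix.cons_val_zero, Matrix.cons_val_one, Matrix.cons_val] at h0'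
    push_cast at h0'
    simp only [hW0, hW1, hW2] at h0'
    -- Subtracting `u₁` and `u₂` times the first column leaves the Padé determinant at `x`, scaled
    -- by these factors. It is a nonzero polynomial, so it does not vanish for small `x > 0`.
    refine mul_ne_zero (mul_ne_zero (mul_ne_zero (pow_ne_zero 3 hb0)
      (pow_ne_zero 3 (hD.ne_zero k))) (mul_ne_zero (h₁.ne_zero k) (h₂.ne_zero k))) hk ?_
    rw [← h0', evalL_detL]
    simp only [padeTriple]
    ring
  · simp only [Matrix.of_apply, Matrix.cons_val_zero, hW0]
    rw [abs_mul, abs_mul, abs_of_nonneg (by positivity : (0 : ℝ) ≤ (b : ℝ) ^ (E * d ^ k)),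
      mul_comm]
    gcongr
    have h3 : |D k| * |evalL (q i) ((1 / (b : ℝ)) ^ (s * d ^ k))| ≤ M * ∑ j, V j :=
      mul_le_mul (hM k) ((hV i _ hx.1.le (by linarith)).trans (hle V hV0 i)) (abs_nonneg _) hM0
    linarith
  · simp only [Matrix.of_apply, Matrix.cons_val_zero, Matrix.cons_val_one, hW0, hW1]
    have h3 := (hA i k).trans (hle A hA0 i)
    have h4 : 0 ≤ M * ∑ j, V j := by positivity
    linarith
  · simp only [Matrix.of_apply, Matrix.cons_val_zero, Matrix.cons_val,
      hW0, hW2]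
    have h3 := (hB i k).trans (hle B hB0 i)
    have h4 : 0 ≤ M * ∑ j, V j := by positivity
    linarith

end Levels

theorem abs_tsum_le_mul {t : ℕ → ℝ} {τ : ℕ → ℝ} {y : ℝ} (hτ : Summable τ)
    (h : ∀ j, |t j| ≤ τ j * y) : |∑' j, t j| ≤ (∑' j, τ j) * y :=
  tsum_of_norm_bounded (f := t) (hτ.hasSum.mul_right y) h

/-- Turns summability at `1 / 2` into bounds linear in `y` on `(0, 1/2]`. -/
theorem pow_le_two_mul_half_pow_mul {n : ℕ} (hn : 1 ≤ n) {y : ℝ} (h0 : 0 < y) (h1 : y ≤ 1 / 2) :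
    y ^ n ≤ 2 * (1 / 2) ^ n * y := by
  obtain ⟨k, rfl⟩ := Nat.exists_eq_add_of_le' hn
  rw [pow_succ, pow_succ]
  have : y ^ k ≤ (1 / 2) ^ k := by gcongr
  nlinarith

/-! ### Stern functions -/

section Stern

theorem abs_series_sub_le {c : ℕ → ℝ} {y : ℝ} (hc : Summable fun n => c n * (1 / 2) ^ n)
    (hy : Summable fun n => c n * y ^ n) (h0 : 0 < y) (h1 : y ≤ 1 / 2) :
    |∑' n, c n * y ^ n - c 0| ≤ (∑' n : ℕ, 2 * |c (n + 1) * (1 / 2) ^ (n + 1)|) * y := by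
  rw [hy.tsum_eq_zero_add, pow_zero, mul_one, add_sub_cancel_left]
  refine abs_tsum_le_mul (((summable_nat_add_iff 1).2 hc.abs).mul_left 2) fun n => ?_
  have h2 : (0 : ℝ) < (1 / 2) ^ (n + 1) := by positivity
  rw [abs_mul, abs_mul, abs_of_pos (pow_pos h0 _), abs_of_pos h2]
  have := pow_le_two_mul_half_pow_mul (n := n + 1) (by omega) h0 h1
  calc _ ≤ |c (n + 1)| * (2 * (1 / 2) ^ (n + 1) * y) := by gcongr
    _ = _ := by ring

/-- Functional equation of `∑ c (n + 1) z ^ n` for sequences with Stern type recurrences. -/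
theorem tsum_stern_rec {c : ℕ → ℤ} {ε z : ℝ} (hz : |z| < 1)
    (he : ∀ n, 1 ≤ n → (c (2 * n) : ℝ) = ε * c n)
    (ho : ∀ n, 1 ≤ n → (c (2 * n + 1) : ℝ) = ε * (c n + c (n + 1)))
    (hs : ∀ {y : ℝ}, |y| < 1 → Summable fun n => (c (n + 1) : ℝ) * y ^ n) :
    ∑' n, (c (n + 1) : ℝ) * z ^ n = (1 - ε) * c 1 +
      ε * (1 + z + z ^ 2) * ∑' n, (c (n + 1) : ℝ) * (z ^ 2) ^ n := by
  have hz2 : |z ^ 2| < 1 := by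
    rw [abs_pow]; exact pow_lt_one₀ (abs_nonneg z) hz (by norm_num)
  have hS := hs hz
  have hS2 := hs hz2
  have hev : Summable fun n => (c (2 * n + 1) : ℝ) * z ^ (2 * n) :=
    hS.comp_injective (i := fun n => 2 * n) fun a b h => by simpa using h
  have hod : Summable fun n => (c (2 * n + 1 + 1) : ℝ) * z ^ (2 * n + 1) :=
    hS.comp_injective (i := fun n => 2 * n + 1) fun a b h => by simpa using h
  rw [← tsum_even_add_odd (f := fun n => (c (n + 1) : ℝ) * z ^ n) hev hod]
  have h1 : ∑' n, (c (2 * n + 1 + 1) : ℝ) * z ^ (2 * n + 1) =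
      ε * z * ∑' n, (c (n + 1) : ℝ) * (z ^ 2) ^ n := by
    rw [← tsum_mul_left]
    refine tsum_congr fun n => ?_
    rw [show 2 * n + 1 + 1 = 2 * (n + 1) by ring, he (n + 1) (by omega), pow_succ, pow_mul]
    ring
  -- The odd recurrence starts at `n = 1`, so the term `c 1` is split off and the shifted sum lacks
  -- `ε * c 1`; this yields the constant `(1 - ε) * c 1`.
  have h2 : ∑' n, (c (2 * n + 1) : ℝ) * z ^ (2 * n) = (1 - ε) * c 1 +
      ε * (1 + z ^ 2) * ∑' n, (c (n + 1) : ℝ) * (z ^ 2) ^ n := by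
    rw [hev.tsum_eq_zero_add]
    have h3 : ∑' n, (c (2 * (n + 1) + 1) : ℝ) * z ^ (2 * (n + 1)) =
        ε * z ^ 2 * ∑' n, (c (n + 1) : ℝ) * (z ^ 2) ^ n +
        ε * ∑' n, (c (n + 1 + 1) : ℝ) * (z ^ 2) ^ (n + 1) := by
      rw [← tsum_mul_left, ← tsum_mul_left, ← (hS2.mul_left _).tsum_add
        (((summable_nat_add_iff 1).2 hS2).mul_left _)]
      refine tsum_congr fun n => ?_
      rw [ho (n + 1) (by omega), pow_mul]
      ring
    have h4 := hS2.tsum_eq_zero_add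
    rw [h3]
    simp only [pow_zero, mul_one, mul_zero, zero_add] at h4 ⊢
    linear_combination (-ε) * h4
  rw [h1, h2]
  ring

theorem sternA_eq {z : ℝ} (hz : |z| < 1) : sternA z = (1 + z + z ^ 2) * sternA (z ^ 2) := by
  have h := tsum_stern_rec (c := sternSeq) (ε := 1) (z := z) hz
    (fun n hn => by rw [sternSeq_even n hn]; simp)
    (fun n hn => by rw [sternSeq_odd n hn]; simp) summable_sternA
  simpa [sternA] using h

theorem sternB_eq {z : ℝ} (hz : |z| < 1) :
    sternB z = 2 - (1 + z + z ^ 2) * sternB (z ^ 2) := by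
  have h := tsum_stern_rec (c := twistedSternSeq) (ε := -1) (z := z)
    hz (fun n hn => by rw [twistedSternSeq_even n hn]; simp)
    (fun n hn => by rw [twistedSternSeq_odd n hn]; push_cast; ring) summable_sternB
  rw [sternB, h, sternB]
  simp only [twistedSternSeq]
  push_cast
  ring

theorem abs_pow_lt_one_of_abs_lt_one {z : ℝ} (hz : |z| < 1) {n : ℕ} (hn : n ≠ 0) : |z ^ n| < 1 := by
  rw [abs_pow]; exact pow_lt_one₀ (abs_nonneg z) hz hn

theorem sternA_iterate {z : ℝ} (hz : |z| < 1) (k : ℕ) :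
    sternA z = (∏ j ∈ Finset.range k, (1 + z ^ 2 ^ j + (z ^ 2 ^ j) ^ 2)) * sternA (z ^ 2 ^ k) := by
  induction k with
  | zero => simp
  | succ k ih =>
    rw [ih, sternA_eq (abs_pow_lt_one_of_abs_lt_one hz (n := 2 ^ k) (by positivity)),
      Finset.prod_range_succ, pow_succ 2 k, pow_mul, mul_assoc]

theorem sternB_iterate {z : ℝ} (hz : |z| < 1) (k : ℕ) :
    sternB z = ∑ i ∈ Finset.range k,
        2 * (-1) ^ i * ∏ j ∈ Finset.range i, (1 + z ^ 2 ^ j + (z ^ 2 ^ j) ^ 2) +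
      (-1) ^ k * (∏ j ∈ Finset.range k, (1 + z ^ 2 ^ j + (z ^ 2 ^ j) ^ 2)) *
        sternB (z ^ 2 ^ k) := by
  induction k with
  | zero => simp
  | succ k ih =>
    rw [ih, sternB_eq (abs_pow_lt_one_of_abs_lt_one hz (n := 2 ^ k) (by positivity)),
      Finset.prod_range_succ, Finset.sum_range_succ, pow_succ 2 k, pow_mul, pow_succ (-1 : ℝ)]
    ring

theorem sternSeq_nonneg (n : ℕ) : 0 ≤ sternSeq n := by
  induction n using Nat.strong_induction_on with
  | _ n ih =>
    match n, ih with
    | 0, _ => simp [sternSeq]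
    | 1, _ => simp [sternSeq]
    | n + 2, ih =>
      rw [sternSeq]
      have h1 := ih (n / 2 + 1) (by omega)
      split_ifs with h
      · exact h1
      · exact add_nonneg h1 (ih (n / 2 + 2) (by omega))

theorem one_le_sternA {z : ℝ} (h0 : 0 ≤ z) (hz : z < 1) : 1 ≤ sternA z := by
  have h := (summable_sternA (z := z) (by rwa [abs_of_nonneg h0])).sum_le_tsum {0}
    (fun n _ => mul_nonneg (by exact_mod_cast sternSeq_nonneg _) (pow_nonneg h0 n))
  rw [sternA]
  simpa [sternSeq] using h

variable {b : ℕ}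

theorem abs_one_div_lt_one (hb : 2 ≤ b) : |1 / (b : ℝ)| < 1 := by
  have h := one_div_pow_mem hb (le_refl 1)
  rw [pow_one] at h
  rw [abs_of_pos h.1]
  linarith

theorem prod_stern_mem_intRange (hb : 2 ≤ b) (k : ℕ) : (b : ℝ) ^ (2 * 2 ^ k) *
    ∏ j ∈ Finset.range k, (1 + (1 / (b : ℝ)) ^ 2 ^ j + ((1 / (b : ℝ)) ^ 2 ^ j) ^ 2) ∈
      intRange := by
  induction k with
  | zero => simpa using natCast_pow_mem_intRange b 2
  | succ k ih =>
    have h1 := pow_mul_one_div_pow (b := b) (by omega) (2 ^ k)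
    have h2 : (b : ℝ) ^ (2 * 2 ^ k) *
        (1 + (1 / (b : ℝ)) ^ 2 ^ k + ((1 / (b : ℝ)) ^ 2 ^ k) ^ 2) ∈ intRange := by
      have h3 : (b : ℝ) ^ (2 * 2 ^ k) *
          (1 + (1 / (b : ℝ)) ^ 2 ^ k + ((1 / (b : ℝ)) ^ 2 ^ k) ^ 2) =
          (b : ℝ) ^ (2 * 2 ^ k) + (b : ℝ) ^ 2 ^ k + 1 := by
        rw [mul_comm 2, pow_mul]
        linear_combination ((b : ℝ) ^ 2 ^ k + 1 + (b : ℝ) ^ 2 ^ k * (1 / (b : ℝ)) ^ 2 ^ k) * h1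
      rw [h3]
      exact add_mem (add_mem (natCast_pow_mem_intRange _ _) (natCast_pow_mem_intRange _ _))
        (one_mem _)
    convert mul_mem ih h2 using 1
    rw [Finset.prod_range_succ, pow_succ 2 k, ← mul_assoc,
      show 2 * (2 ^ k * 2) = 2 * 2 ^ k + 2 * 2 ^ k by ring, pow_add]
    ring

/-- The last product in the sum has only `k - 1` factors, so half the power needed for the full
product suffices. -/
theorem sum_stern_mem_intRange (hb : 2 ≤ b) (k : ℕ) :
    (b : ℝ) ^ 2 ^ k * ∑ i ∈ Finset.range k, 2 * (-1) ^ i * ∏ j ∈ Finset.range i,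
      (1 + (1 / (b : ℝ)) ^ 2 ^ j + ((1 / (b : ℝ)) ^ 2 ^ j) ^ 2) ∈ intRange := by
  induction k with
  | zero => simp
  | succ k ih =>
    have h1 : (2 * (-1) ^ k : ℝ) ∈ intRange :=
      mul_mem (ofNat_mem _ 2) (pow_mem (neg_mem (one_mem _)) _)
    have h2 := mul_mem h1 (prod_stern_mem_intRange hb k)
    rw [Finset.sum_range_succ, mul_add]
    refine add_mem (pow_mul_mem_intRange_of_le ih (Nat.pow_le_pow_right (by omega) (by omega))) ?_
    convert h2 using 1
    rw [pow_succ 2 k, mul_comm (2 ^ k) 2]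
    ring

theorem prod_stern_pos (z : ℝ) (k : ℕ) :
    0 < ∏ j ∈ Finset.range k, (1 + z ^ 2 ^ j + (z ^ 2 ^ j) ^ 2) :=
  Finset.prod_pos fun j _ => by nlinarith [sq_nonneg (z ^ 2 ^ j + 1), sq_nonneg (z ^ 2 ^ j)]

/-- The product is `sternA (1 / b) / sternA x` with `x = b ^ (-2 ^ k)`, and `sternA x ≥ 1`. -/
theorem abs_prod_stern_le (hb : 2 ≤ b) (k : ℕ) :
    |∏ j ∈ Finset.range k, (1 + (1 / (b : ℝ)) ^ 2 ^ j + ((1 / (b : ℝ)) ^ 2 ^ j) ^ 2)| ≤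
      sternA (1 / (b : ℝ)) := by
  have h1 := one_div_pow_mem hb (Nat.one_le_two_pow (n := k))
  have h2 := one_le_sternA h1.1.le (by linarith)
  have h3 := prod_stern_pos (1 / (b : ℝ)) k
  rw [sternA_iterate (abs_one_div_lt_one hb) k, abs_of_pos h3]
  nlinarith

theorem levelDenominator_one (b d : ℕ) : LevelDenominator b d (fun _ => 1) 0 where
  ne_zero _ := one_ne_zero
  bounded := ⟨1, by simp⟩
  integral k := by simp

theorem levelExpansion_sternA (hb : 2 ≤ b) : LevelExpansion b 2 1 (sternA (1 / (b : ℝ))) sternA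
    (fun _ => 1) (fun _ => 0) (fun k => ∏ j ∈ Finset.range k,
      (1 + (1 / (b : ℝ)) ^ 2 ^ j + ((1 / (b : ℝ)) ^ 2 ^ j) ^ 2)) 0 2 where
  eq k := by
    rw [zero_add, one_mul]
    exact sternA_iterate (abs_one_div_lt_one hb) k
  ne_zero k := (prod_stern_pos _ k).ne'
  bounded := ⟨_, fun k => by rw [one_mul]; exact abs_prod_stern_le hb k⟩
  integral_u k := by simp
  integral_w k := by rw [one_mul]; exact prod_stern_mem_intRange hb k

theorem levelExpansion_sternB (hb : 2 ≤ b) : LevelExpansion b 2 1 (sternB (1 / (b : ℝ))) sternB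
    (fun _ => 1) (fun k => ∑ i ∈ Finset.range k, 2 * (-1) ^ i * ∏ j ∈ Finset.range i,
      (1 + (1 / (b : ℝ)) ^ 2 ^ j + ((1 / (b : ℝ)) ^ 2 ^ j) ^ 2))
    (fun k => (-1) ^ k * ∏ j ∈ Finset.range k,
      (1 + (1 / (b : ℝ)) ^ 2 ^ j + ((1 / (b : ℝ)) ^ 2 ^ j) ^ 2)) 1 2 where
  eq k := by
    rw [one_mul]
    exact sternB_iterate (abs_one_div_lt_one hb) k
  ne_zero k := mul_ne_zero (by simp) (prod_stern_pos _ k).ne'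
  bounded := ⟨sternA (1 / (b : ℝ)), fun k => by
    rw [one_mul, abs_mul, abs_pow, abs_neg, abs_one, one_pow, one_mul]
    exact abs_prod_stern_le hb k⟩
  integral_u k := by rw [one_mul, one_mul]; exact sum_stern_mem_intRange hb k
  integral_w k := by
    rw [one_mul, mul_left_comm]
    exact mul_mem (pow_mem (neg_mem (one_mem _)) _) (prod_stern_mem_intRange hb k)

end Stern

/-! ### Thue–Morse functions -/

section ThueMorse

theorem thueMorseT_eq {z : ℝ} (hz : |z| < 1) : thueMorseT z = (1 - z) * thueMorseT (z ^ 2) := by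
  have h := (multipliable_thueMorseT (abs_pow_lt_one_of_abs_lt_one hz two_ne_zero)).hasProd
  have h2 : HasProd (fun j : ℕ => 1 - z ^ 2 ^ (j + 1)) (thueMorseT (z ^ 2)) := by
    refine h.congr_fun ?_
    intro j
    rw [← pow_mul, ← pow_succ']
  have h3 := HasProd.zero_mul (f := fun j : ℕ => 1 - z ^ 2 ^ j) h2
  rw [pow_zero, pow_one] at h3
  exact h3.tprod_eq

theorem prod_thueMorse_pos {z : ℝ} (hz : |z| < 1) (k : ℕ) :
    0 < ∏ j ∈ Finset.range k, (1 - z ^ 2 ^ j) :=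
  Finset.prod_pos fun j _ => by
    have := (le_abs_self _).trans_lt (abs_pow_lt_one_of_abs_lt_one hz (n := 2 ^ j) (by positivity))
    linarith

theorem thueMorseM_eq {z : ℝ} (hz : |z| < 1) :
    (1 - z) * thueMorseM z = z * (1 - z) - thueMorseM (z ^ 2) := by
  have h1 : 0 < 1 - z := by linarith [le_abs_self z]
  have h2 : (1 - z) * ∑' j : ℕ, (-1) ^ (j + 1) * z ^ 2 ^ (j + 1) /
      ∏ i ∈ Finset.range (j + 1), (1 - z ^ 2 ^ i) = -thueMorseM (z ^ 2) := by
    rw [thueMorseM, ← tsum_mul_left, ← tsum_neg]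
    refine tsum_congr fun j => ?_
    rw [Finset.prod_range_succ', pow_zero, pow_one, pow_succ' 2 j, pow_mul, pow_succ (-1 : ℝ)]
    have h3 : ∀ i, z ^ 2 ^ (i + 1) = (z ^ 2) ^ 2 ^ i := fun i => by rw [pow_succ' 2 i, pow_mul]
    simp only [h3]
    have h4 := (prod_thueMorse_pos (abs_pow_lt_one_of_abs_lt_one hz two_ne_zero) j).ne'
    field_simp
  rw [thueMorseM, (summable_thueMorseM hz).tsum_eq_zero_add, mul_add, h2]
  simp
  ring

theorem thueMorseT_iterate {z : ℝ} (hz : |z| < 1) (k : ℕ) :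
    thueMorseT z = (∏ j ∈ Finset.range k, (1 - z ^ 2 ^ j)) * thueMorseT (z ^ 2 ^ k) := by
  induction k with
  | zero => simp
  | succ k ih =>
    rw [ih, thueMorseT_eq (abs_pow_lt_one_of_abs_lt_one hz (n := 2 ^ k) (by positivity)),
      Finset.prod_range_succ, pow_succ 2 k, pow_mul, mul_assoc]

theorem thueMorseM_iterate {z : ℝ} (hz : |z| < 1) (k : ℕ) :
    thueMorseM z = ∑ j ∈ Finset.range k,
        (-1) ^ j * z ^ 2 ^ j / ∏ i ∈ Finset.range j, (1 - z ^ 2 ^ i) +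
      (-1) ^ k / (∏ i ∈ Finset.range k, (1 - z ^ 2 ^ i)) * thueMorseM (z ^ 2 ^ k) := by
  induction k with
  | zero => simp
  | succ k ih =>
    have h1 := thueMorseM_eq (abs_pow_lt_one_of_abs_lt_one hz (n := 2 ^ k) (by positivity))
    have h2 := (prod_thueMorse_pos hz k).ne'
    have h3 := prod_thueMorse_pos hz (k + 1)
    rw [Finset.prod_range_succ] at h3
    have h4 := right_ne_zero_of_mul h3.ne'
    rw [ih, Finset.prod_range_succ, Finset.sum_range_succ, pow_succ 2 k, pow_mul,
      pow_succ (-1 : ℝ), add_assoc]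
    congr 1
    field_simp
    linear_combination h1

variable {b : ℕ}

theorem one_sub_mem_Icc (hb : 2 ≤ b) (j : ℕ) :
    0 ≤ 1 - (1 / (b : ℝ)) ^ 2 ^ j ∧ 1 - (1 / (b : ℝ)) ^ 2 ^ j ≤ 1 := by
  have h1 := one_div_pow_mem hb (Nat.one_le_two_pow (n := j))
  constructor <;> linarith

theorem pow_mul_one_sub_mem_intRange (hb : 2 ≤ b) (n : ℕ) :
    (b : ℝ) ^ n * (1 - (1 / (b : ℝ)) ^ n) ∈ intRange := by
  rw [mul_sub, pow_mul_one_div_pow (by omega), mul_one]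
  exact sub_mem (natCast_pow_mem_intRange _ _) (one_mem _)

theorem levelDenominator_thueMorse (hb : 2 ≤ b) : LevelDenominator b 2
    (fun k => ∏ j ∈ Finset.range k, (1 - (1 / (b : ℝ)) ^ 2 ^ j)) 1 where
  ne_zero k := (prod_thueMorse_pos (abs_one_div_lt_one hb) k).ne'
  bounded := ⟨1, fun k => by
    rw [abs_of_pos (prod_thueMorse_pos (abs_one_div_lt_one hb) k)]
    exact Finset.prod_le_one (fun j _ => (one_sub_mem_Icc hb j).1)
      fun j _ => (one_sub_mem_Icc hb j).2⟩
  integral k := by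
    induction k with
    | zero => simp
    | succ k ih =>
      convert mul_mem ih (pow_mul_one_sub_mem_intRange hb (2 ^ k)) using 1
      rw [Finset.prod_range_succ, one_mul, one_mul, pow_succ 2 k, mul_two, pow_add]
      ring

theorem levelExpansion_thueMorseT (hb : 2 ≤ b) :
    LevelExpansion b 2 1 (thueMorseT (1 / (b : ℝ))) thueMorseT
      (fun k => ∏ j ∈ Finset.range k, (1 - (1 / (b : ℝ)) ^ 2 ^ j)) (fun _ => 0)
      (fun k => ∏ j ∈ Finset.range k, (1 - (1 / (b : ℝ)) ^ 2 ^ j)) 0 2 where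
  eq k := by
    rw [zero_add, one_mul]
    exact thueMorseT_iterate (abs_one_div_lt_one hb) k
  ne_zero := (levelDenominator_thueMorse hb).ne_zero
  bounded := by
    obtain ⟨C, hC⟩ := (levelDenominator_thueMorse hb).bounded
    exact ⟨C * C, fun k => by
      rw [abs_mul]
      exact mul_le_mul (hC k) (hC k) (abs_nonneg _) ((abs_nonneg _).trans (hC k))⟩
  integral_u k := by simp
  integral_w k := by
    have h := (levelDenominator_thueMorse hb).integral k
    convert mul_mem h h using 1
    rw [one_mul, two_mul, pow_add]
    ring

theorem levelExpansion_thueMorseM (hb : 2 ≤ b) :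
    LevelExpansion b 2 1 (thueMorseM (1 / (b : ℝ))) thueMorseM
      (fun k => ∏ j ∈ Finset.range k, (1 - (1 / (b : ℝ)) ^ 2 ^ j))
      (fun k => ∑ j ∈ Finset.range k, (-1) ^ j * (1 / (b : ℝ)) ^ 2 ^ j /
        ∏ i ∈ Finset.range j, (1 - (1 / (b : ℝ)) ^ 2 ^ i))
      (fun k => (-1) ^ k / ∏ j ∈ Finset.range k, (1 - (1 / (b : ℝ)) ^ 2 ^ j)) 1 0 where
  eq k := by
    rw [one_mul]
    exact thueMorseM_iterate (abs_one_div_lt_one hb) k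
  ne_zero k := div_ne_zero (by simp) ((levelDenominator_thueMorse hb).ne_zero k)
  bounded := ⟨1, fun k => by
    rw [mul_div_cancel₀ _ ((levelDenominator_thueMorse hb).ne_zero k)]
    simp⟩
  integral_u k := by
    induction k with
    | zero => simp
    | succ k ih =>
      have h1 := pow_mul_one_sub_mem_intRange hb (2 ^ k)
      have h2 : (-1 : ℝ) ^ k ∈ intRange := pow_mem (neg_mem (one_mem _)) _
      -- With `x = b ^ (-2 ^ k)`, the recursion is `D' u' = (1 - x) (D u + (-1) ^ k x)`; one factor
      -- `b ^ 2 ^ k` clears `1 - x`, the other clears the second bracket.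
      convert add_mem (mul_mem ih h1) (mul_mem h2 h1) using 1
      have h3 := (levelDenominator_thueMorse hb).ne_zero k
      beta_reduce at h3
      have h4 := pow_mul_one_div_pow (b := b) (by omega) (2 ^ k)
      rw [Finset.prod_range_succ, Finset.sum_range_succ, one_mul, one_mul, pow_succ 2 k,
        mul_two, pow_add]
      set P := ∏ j ∈ Finset.range k, (1 - (1 / (b : ℝ)) ^ 2 ^ j)
      set x := (1 / (b : ℝ)) ^ 2 ^ k
      have h5 : P * ((-1) ^ k * x / P) = (-1) ^ k * x := mul_div_cancel₀ _ h3
      linear_combination (b : ℝ) ^ 2 ^ k * (b : ℝ) ^ 2 ^ k * (1 - x) * h5 +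
        (-1) ^ k * (b : ℝ) ^ 2 ^ k * (1 - x) * h4
  integral_w k := by
    rw [mul_div_cancel₀ _ ((levelDenominator_thueMorse hb).ne_zero k), zero_mul, pow_zero,
      one_mul]
    exact pow_mem (neg_mem (one_mem _)) _

end ThueMorse

/-! ### Lambert series -/

section Lambert

theorem lambertG_eq {d : ℕ} (hd : 2 ≤ d) {z : ℝ} (hz : |z| < 1) :
    lambertG d z = z / (1 - z) + lambertG d (z ^ d) := by
  rw [lambertG, (summable_lambert hd hz).1.tsum_eq_zero_add, lambertG]
  simp only [pow_zero, pow_one, pow_succ' d, pow_mul]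

theorem lambertF_eq {d : ℕ} (hd : 2 ≤ d) {z : ℝ} (hz : |z| < 1) :
    lambertF d z = z / (1 + z) + lambertF d (z ^ d) := by
  rw [lambertF, (summable_lambert hd hz).2.tsum_eq_zero_add, lambertF]
  simp only [pow_zero, pow_one, pow_succ' d, pow_mul]

theorem lambertG_iterate {d : ℕ} (hd : 2 ≤ d) {z : ℝ} (hz : |z| < 1) (k : ℕ) :
    lambertG d z = ∑ j ∈ Finset.range k, z ^ d ^ j / (1 - z ^ d ^ j) + lambertG d (z ^ d ^ k) := by
  induction k with
  | zero => simp
  | succ k ih =>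
    rw [ih, lambertG_eq hd (abs_pow_lt_one_of_abs_lt_one hz (n := d ^ k) (by positivity)),
      Finset.sum_range_succ, pow_succ d k, pow_mul, add_assoc]

theorem lambertF_iterate {d : ℕ} (hd : 2 ≤ d) {z : ℝ} (hz : |z| < 1) (k : ℕ) :
    lambertF d z = ∑ j ∈ Finset.range k, z ^ d ^ j / (1 + z ^ d ^ j) + lambertF d (z ^ d ^ k) := by
  induction k with
  | zero => simp
  | succ k ih =>
    rw [ih, lambertF_eq hd (abs_pow_lt_one_of_abs_lt_one hz (n := d ^ k) (by positivity)),
      Finset.sum_range_succ, pow_succ d k, pow_mul, add_assoc]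

variable {b d : ℕ}

theorem pow_mul_one_sub_sq (hb : 2 ≤ b) (n : ℕ) :
    (b : ℝ) ^ (2 * n) * (1 - ((1 / (b : ℝ)) ^ n) ^ 2) = ((b : ℝ) ^ n) ^ 2 - 1 := by
  have h := pow_mul_one_div_pow (b := b) (by omega) n
  rw [mul_comm 2, pow_mul]
  linear_combination (-1 - (b : ℝ) ^ n * (1 / (b : ℝ)) ^ n) * h

theorem one_sub_one_div_pow_sq_mem (hb : 2 ≤ b) (hd : 1 ≤ d) (k : ℕ) :
    0 < 1 - ((1 / (b : ℝ)) ^ d ^ k) ^ 2 ∧ 1 - ((1 / (b : ℝ)) ^ d ^ k) ^ 2 ≤ 1 := by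
  have h := one_div_pow_mem hb (Nat.one_le_pow k d hd)
  constructor <;> nlinarith

theorem levelDenominator_lambert (hb : 2 ≤ b) (hd : 1 ≤ d) :
    LevelDenominator b d (fun k => 1 - ((1 / (b : ℝ)) ^ d ^ k) ^ 2) 2 where
  ne_zero k := (one_sub_one_div_pow_sq_mem hb hd k).1.ne'
  bounded := ⟨1, fun k => by
    rw [abs_of_pos (one_sub_one_div_pow_sq_mem hb hd k).1]
    exact (one_sub_one_div_pow_sq_mem hb hd k).2⟩
  integral k := by
    rw [pow_mul_one_sub_sq hb]
    exact sub_mem (pow_mem (natCast_pow_mem_intRange _ _) _) (one_mem _)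

/-- `b ^ d ^ j - ε` divides `b ^ (2 d ^ j) - 1`, which divides `b ^ (2 d ^ k) - 1`. Both signs are
covered, so `G` and `F` share one denominator. -/
theorem lambert_term_mem_intRange (hb : 2 ≤ b) (hd : 1 ≤ d) {j k : ℕ} (hjk : j ≤ k) {ε : ℤ}
    (hε : ε ^ 2 = 1) : (((b : ℝ) ^ d ^ k) ^ 2 - 1) *
      ((1 / (b : ℝ)) ^ d ^ j / (1 - ε * (1 / (b : ℝ)) ^ d ^ j)) ∈ intRange := by
  obtain ⟨i, rfl⟩ := Nat.exists_eq_add_of_le hjk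
  have hdvd : (b : ℤ) ^ d ^ j - ε ∣ ((b : ℤ) ^ d ^ (j + i)) ^ 2 - 1 := by
    refine (Dvd.intro (((b : ℤ) ^ d ^ j) + ε) (by ring : _ =
      ((b : ℤ) ^ d ^ j) ^ 2 - ε ^ 2)).trans ?_
    rw [hε, pow_add, pow_mul, ← pow_mul _ (d ^ i) 2, mul_comm (d ^ i), pow_mul _ 2 (d ^ i)]
    simpa using sub_dvd_pow_sub_pow (((b : ℤ) ^ d ^ j) ^ 2) 1 (d ^ i)
  obtain ⟨t, ht⟩ := hdvd
  have ht' : (((b : ℝ) ^ d ^ (j + i)) ^ 2 - 1) = ((b : ℝ) ^ d ^ j - ε) * t := by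
    exact_mod_cast congrArg (Int.cast : ℤ → ℝ) ht
  have hx := one_div_pow_mem hb (Nat.one_le_pow j d hd)
  have hε' : |(ε : ℝ)| ≤ 1 := by
    have : (ε : ℝ) ^ 2 = 1 := by exact_mod_cast hε
    rw [← sq_le_one_iff_abs_le_one, this]
  have h1 : (0 : ℝ) < 1 - ε * (1 / (b : ℝ)) ^ d ^ j := by
    have := (abs_le.1 hε').2
    nlinarith
  have h2 := pow_mul_one_div_pow (b := b) (by omega) (d ^ j)
  have h3 : ((b : ℝ) ^ d ^ j - ε) * t *
      ((1 / (b : ℝ)) ^ d ^ j / (1 - ε * (1 / (b : ℝ)) ^ d ^ j)) = t := by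
    rw [mul_div_assoc', div_eq_iff h1.ne']
    linear_combination (t : ℝ) * h2
  rw [ht', h3]
  exact intCast_mem _ _

/-- The denominator of level `k` already clears the term `j = k`, so one more step is taken and `f`
is evaluated at `b ^ (-d ^ (k + 1))`; hence `s = d`. -/
theorem levelExpansion_lambertG (hb : 2 ≤ b) (hd : 2 ≤ d) :
    LevelExpansion b d d (lambertG d (1 / (b : ℝ))) (lambertG d)
      (fun k => 1 - ((1 / (b : ℝ)) ^ d ^ k) ^ 2)
      (fun k => ∑ j ∈ Finset.range (k + 1), (1 / (b : ℝ)) ^ d ^ j / (1 - (1 / (b : ℝ)) ^ d ^ j))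
      (fun _ => 1) 2 2 where
  eq k := by
    rw [one_mul, ← pow_succ' d k]
    exact lambertG_iterate hd (abs_one_div_lt_one hb) (k + 1)
  ne_zero k := one_ne_zero
  bounded := by simpa using (levelDenominator_lambert hb (by omega : 1 ≤ d)).bounded
  integral_u k := by
    rw [← mul_assoc, pow_mul_one_sub_sq hb, Finset.mul_sum]
    refine sum_mem fun j hj => ?_
    have h := lambert_term_mem_intRange (ε := 1) hb (by omega : 1 ≤ d)
      (Nat.lt_succ_iff.1 (Finset.mem_range.1 hj)) (by norm_num)
    simpa only [Int.cast_one, one_mul] using h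
  integral_w k := by
    rw [mul_one]
    exact (levelDenominator_lambert hb (by omega : 1 ≤ d)).integral k

theorem levelExpansion_lambertF (hb : 2 ≤ b) (hd : 2 ≤ d) :
    LevelExpansion b d d (lambertF d (1 / (b : ℝ))) (lambertF d)
      (fun k => 1 - ((1 / (b : ℝ)) ^ d ^ k) ^ 2)
      (fun k => ∑ j ∈ Finset.range (k + 1), (1 / (b : ℝ)) ^ d ^ j / (1 + (1 / (b : ℝ)) ^ d ^ j))
      (fun _ => 1) 2 2 where
  eq k := by
    rw [one_mul, ← pow_succ' d k]
    exact lambertF_iterate hd (abs_one_div_lt_one hb) (k + 1)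
  ne_zero k := one_ne_zero
  bounded := by simpa using (levelDenominator_lambert hb (by omega : 1 ≤ d)).bounded
  integral_u k := by
    rw [← mul_assoc, pow_mul_one_sub_sq hb, Finset.mul_sum]
    refine sum_mem fun j hj => ?_
    have h := lambert_term_mem_intRange (ε := -1) hb (by omega : 1 ≤ d)
      (Nat.lt_succ_iff.1 (Finset.mem_range.1 hj)) (by norm_num)
    simpa only [Int.cast_neg, Int.cast_one, neg_mul, one_mul, sub_neg_eq_add] using h
  integral_w k := by
    rw [mul_one]
    exact (levelDenominator_lambert hb (by omega : 1 ≤ d)).integral k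

end Lambert

/-! ### Linear bounds at the origin -/

section NearZero

variable {d : ℕ}

/-- Of the factor 4, one 2 comes from comparison with `1 / 2`, the other from `1 - y ^ d ^ k ≥ 1 /
2` in the denominators of `G`. -/
theorem summable_half_pow_pow (hd : 2 ≤ d) : Summable fun k : ℕ => 4 * (1 / 2 : ℝ) ^ d ^ k := by
  have h := summable_abs_pow_pow hd (z := 1 / 2) (by rw [abs_of_pos] <;> norm_num)
  rw [abs_of_pos (by norm_num)] at h
  exact h.mul_left 4

theorem exists_abs_lambertG_le (hd : 2 ≤ d) : ∃ C : ℝ, ∀ y : ℝ, 0 < y → y ≤ 1 / 2 →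
    |lambertG d y - (0 : ℤ)| ≤ C * y := by
  refine ⟨∑' k : ℕ, 4 * (1 / 2 : ℝ) ^ d ^ k, fun y h0 h1 => ?_⟩
  rw [Int.cast_zero, sub_zero]
  refine abs_tsum_le_mul (summable_half_pow_pow hd) fun j => ?_
  have hj := Nat.one_le_pow j d (by omega)
  have h2 := pow_le_two_mul_half_pow_mul hj h0 h1
  have h3 : y ^ d ^ j ≤ y := pow_le_of_le_one h0.le (by linarith) (by omega)
  have h4 : 0 < y ^ d ^ j := pow_pos h0 _
  rw [abs_div, abs_of_pos h4, abs_of_pos (by linarith), div_le_iff₀ (by linarith)]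
  nlinarith

theorem exists_abs_lambertF_le (hd : 2 ≤ d) : ∃ C : ℝ, ∀ y : ℝ, 0 < y → y ≤ 1 / 2 →
    |lambertF d y - (0 : ℤ)| ≤ C * y := by
  refine ⟨∑' k : ℕ, 4 * (1 / 2 : ℝ) ^ d ^ k, fun y h0 h1 => ?_⟩
  rw [Int.cast_zero, sub_zero]
  refine abs_tsum_le_mul (summable_half_pow_pow hd) fun j => ?_
  have hj := Nat.one_le_pow j d (by omega)
  have h2 := pow_le_two_mul_half_pow_mul hj h0 h1
  have h4 : 0 < y ^ d ^ j := pow_pos h0 _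
  rw [abs_div, abs_of_pos h4, abs_of_pos (by linarith), div_le_iff₀ (by linarith)]
  nlinarith

theorem exists_abs_thueMorseM_le : ∃ C : ℝ, ∀ y : ℝ, 0 < y → y ≤ 1 / 2 →
    |thueMorseM y - (0 : ℤ)| ≤ C * y := by
  have hhalf : |(1 / 2 : ℝ)| < 1 := by rw [abs_of_pos] <;> norm_num
  refine ⟨∑' j : ℕ, 2 * |(-1) ^ j * (1 / 2 : ℝ) ^ 2 ^ j /
    ∏ i ∈ Finset.range j, (1 - (1 / 2 : ℝ) ^ 2 ^ i)|, fun y h0 h1 => ?_⟩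
  rw [Int.cast_zero, sub_zero]
  refine abs_tsum_le_mul ((summable_thueMorseM hhalf).abs.mul_left 2) fun j => ?_
  have hy : |y| < 1 := by rw [abs_of_pos h0]; linarith
  have h2 := pow_le_two_mul_half_pow_mul (Nat.one_le_two_pow (n := j)) h0 h1
  -- The denominators decrease in `y`, so those at `1 / 2` are the worst case.
  have h3 : ∏ i ∈ Finset.range j, (1 - (1 / 2 : ℝ) ^ 2 ^ i) ≤
      ∏ i ∈ Finset.range j, (1 - y ^ 2 ^ i) := by
    refine Finset.prod_le_prod (fun i _ => ?_) fun i _ => ?_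
    · have : (1 / 2 : ℝ) ^ 2 ^ i ≤ 1 := pow_le_one₀ (by norm_num) (by norm_num)
      linarith
    · gcongr
  have h4 := prod_thueMorse_pos hhalf j
  have h5 : (0 : ℝ) < (1 / 2) ^ 2 ^ j := by positivity
  rw [abs_div, abs_div, abs_mul, abs_mul, abs_pow, abs_neg, abs_one, one_pow, one_mul, one_mul,
    abs_of_pos (pow_pos h0 _), abs_of_pos h5, abs_of_pos h4,
    abs_of_pos (prod_thueMorse_pos hy j)]
  calc _ ≤ (2 * (1 / 2) ^ 2 ^ j * y) / ∏ i ∈ Finset.range j, (1 - (1 / 2 : ℝ) ^ 2 ^ i) := by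
        gcongr
    _ = _ := by ring

theorem exists_abs_thueMorseT_le : ∃ C : ℝ, ∀ y : ℝ, 0 < y → y ≤ 1 / 2 →
    |thueMorseT y - (1 : ℤ)| ≤ C * y := by
  refine ⟨∑' k : ℕ, 4 * (1 / 2 : ℝ) ^ 2 ^ k, fun y h0 h1 => ?_⟩
  have hs := summable_half_pow_pow (d := 2) le_rfl
  have hprod := (multipliable_thueMorseT (z := y) (by rw [abs_of_pos h0]; linarith)).hasProd
  have hterm : ∀ j : ℕ, 0 ≤ 1 - y ^ 2 ^ j ∧ 1 - y ^ 2 ^ j ≤ 1 := fun j => by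
    have : y ^ 2 ^ j ≤ 1 := pow_le_one₀ h0.le (by linarith)
    have : 0 < y ^ 2 ^ j := pow_pos h0 _
    constructor <;> linarith
  have hup : thueMorseT y ≤ 1 := le_of_tendsto' hprod fun s =>
    Finset.prod_le_one (fun j _ => (hterm j).1) fun j _ => (hterm j).2
  have hlow : 1 - (∑' k : ℕ, 4 * (1 / 2 : ℝ) ^ 2 ^ k) * y ≤ thueMorseT y := by
    refine ge_of_tendsto' hprod fun s => ?_
    have h2 : ∑ j ∈ s, y ^ 2 ^ j ≤ (∑' k : ℕ, 4 * (1 / 2 : ℝ) ^ 2 ^ k) * y := by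
      calc ∑ j ∈ s, y ^ 2 ^ j ≤ ∑ j ∈ s, 4 * (1 / 2 : ℝ) ^ 2 ^ j * y := by
            refine Finset.sum_le_sum fun j _ => ?_
            have := pow_le_two_mul_half_pow_mul (Nat.one_le_two_pow (n := j)) h0 h1
            have : 0 < (1 / 2 : ℝ) ^ 2 ^ j * y := by positivity
            linarith
        _ = (∑ j ∈ s, 4 * (1 / 2 : ℝ) ^ 2 ^ j) * y := by rw [Finset.sum_mul]
        _ ≤ _ := by
            gcongr
            exact hs.sum_le_tsum _ fun j _ => by positivity
    -- Weierstrass product inequality.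
    have h3 : 1 - ∑ j ∈ s, y ^ 2 ^ j ≤ ∏ j ∈ s, (1 - y ^ 2 ^ j) := by
      clear h2
      induction s using Finset.cons_induction with
      | empty => simp
      | cons j s hj ih =>
        rw [Finset.sum_cons, Finset.prod_cons]
        have h5 : ∏ j ∈ s, (1 - y ^ 2 ^ j) ≤ 1 :=
          Finset.prod_le_one (fun j _ => (hterm j).1) fun j _ => (hterm j).2
        have := (hterm j).1
        have := (hterm j).2
        nlinarith
    linarith
  rw [Int.cast_one, abs_le]
  have : 0 ≤ (∑' k : ℕ, 4 * (1 / 2 : ℝ) ^ 2 ^ k) * y :=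
    mul_nonneg (tsum_nonneg fun k => by positivity) h0.le
  constructor <;> linarith

theorem exists_abs_sternA_le : ∃ C : ℝ, ∀ y : ℝ, 0 < y → y ≤ 1 / 2 →
    |sternA y - (1 : ℤ)| ≤ C * y := by
  refine ⟨∑' n : ℕ, 2 * |(sternSeq (n + 1 + 1) : ℝ) * (1 / 2) ^ (n + 1)|, fun y h0 h1 => ?_⟩
  have h := abs_series_sub_le (summable_sternA (z := 1 / 2) (by rw [abs_of_pos] <;> norm_num))
    (summable_sternA (z := y) (by rw [abs_of_pos h0]; linarith)) h0 h1
  rw [zero_add, show sternSeq 1 = 1 by simp [sternSeq]] at h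
  exact h

theorem exists_abs_sternB_le : ∃ C : ℝ, ∀ y : ℝ, 0 < y → y ≤ 1 / 2 →
    |sternB y - (1 : ℤ)| ≤ C * y := by
  refine ⟨∑' n : ℕ, 2 * |(twistedSternSeq (n + 1 + 1) : ℝ) * (1 / 2) ^ (n + 1)|, fun y h0 h1 => ?_⟩
  have h := abs_series_sub_le (summable_sternB (z := 1 / 2) (by rw [abs_of_pos] <;> norm_num))
    (summable_sternB (z := y) (by rw [abs_of_pos h0]; linarith)) h0 h1
  rw [zero_add, show twistedSternSeq 1 = 1 by simp [twistedSternSeq]] at h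
  exact h

end NearZero

/-! ### Certified expansions -/

theorem ApproxL.mono {f : ℝ → ℝ} {L : List ℤ} {m n : ℕ} (h : ApproxL f L m) (hnm : n ≤ m) :
    ApproxL f L n := by
  obtain ⟨C, hC, h⟩ := h
  refine ⟨C, hC, fun y h0 h1 => (h y h0 h1).trans ?_⟩
  have := pow_le_pow_of_le_one h0.le (by linarith : y ≤ 1) hnm
  gcongr

/-- The first coefficients of the power series of `sternA`. -/
def sternASeries : List ℤ :=
  [1, 1, 2, 1, 3, 2, 3, 1, 4, 3, 5, 2, 5, 3, 4, 1, 5, 4, 7, 3, 8, 5, 7, 2, 7, 5, 8, 3, 7, 4,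
    5, 1, 6, 5, 9, 4, 11, 7, 10, 3, 11, 8, 13, 5, 12, 7, 9]

/-- The first coefficients of the power series of `sternB`. -/
def sternBSeries : List ℤ :=
  [1, -1, 0, 1, 1, 0, -1, -1, -2, -1, -1, 0, 1, 1, 2, 1, 3, 2, 3, 1, 2, 1, 1, 0, -1, -1, -2,
    -1, -3, -2, -3, -1, -4, -3, -5, -2, -5, -3, -4, -1, -3, -2, -3, -1, -2, -1, -1]

/-- The first coefficients of the power series of `thueMorseT`. -/
def thueMorseTSeries : List ℤ :=
  [1, -1, -1, 1, -1, 1, 1, -1, -1, 1]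

/-- The first coefficients of the power series of `thueMorseM`. -/
def thueMorseMSeries : List ℤ :=
  [0, 1, -1, -1, 0, 0, 1, 1, 1, 1]

/-- The first coefficients of the power series of `lambertG 3`. -/
def lambertGSeries : List ℤ :=
  [0, 1, 1, 2, 1, 1]

/-- The first coefficients of the power series of `lambertF 3`. -/
def lambertFSeries : List ℤ :=
  [0, 1, -1, 2, -1, 1]

/-- Order 47 is what the largest Stern table requires; the smaller ones truncate it. -/
theorem approxL_sternA : ApproxL sternA sternASeries 47 :=
  approxL_of_functional_eq (d := 1) (D := [1]) (U := []) (W := [1, 1, 1]) (by norm_num)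
    (fun y h0 h1 => by simp only [evalL]; push_cast; linarith)
    (fun y h0 h1 => by
      have hy : |y| < 1 := by rw [abs_of_pos h0]; linarith
      simp only [evalL]
      push_cast
      linear_combination sternA_eq hy)
    exists_abs_sternA_le (by decide +kernel)

theorem approxL_sternB : ApproxL sternB sternBSeries 47 :=
  approxL_of_functional_eq (d := 1) (D := [1]) (U := [2]) (W := [-1, -1, -1]) (by norm_num)
    (fun y h0 h1 => by simp only [evalL]; push_cast; linarith)
    (fun y h0 h1 => by
      have hy : |y| < 1 := by rw [abs_of_pos h0]; linarith
      simp only [evalL]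
      push_cast
      linear_combination sternB_eq hy)
    exists_abs_sternB_le (by decide +kernel)

theorem approxL_thueMorseT : ApproxL thueMorseT thueMorseTSeries 10 :=
  approxL_of_functional_eq (d := 1) (D := [1]) (U := []) (W := [1, -1]) (by norm_num)
    (fun y h0 h1 => by simp only [evalL]; push_cast; linarith)
    (fun y h0 h1 => by
      have hy : |y| < 1 := by rw [abs_of_pos h0]; linarith
      simp only [evalL]
      push_cast
      linear_combination thueMorseT_eq hy)
    exists_abs_thueMorseT_le (by decide +kernel)

theorem approxL_thueMorseM : ApproxL thueMorseM thueMorseMSeries 10 :=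
  approxL_of_functional_eq (d := 1) (D := [1, -1]) (U := [0, 1, -1]) (W := [-1]) (by norm_num)
    (fun y h0 h1 => by simp only [evalL]; push_cast; linarith)
    (fun y h0 h1 => by
      have hy : |y| < 1 := by rw [abs_of_pos h0]; linarith
      simp only [evalL]
      push_cast
      linear_combination thueMorseM_eq hy)
    exists_abs_thueMorseM_le (by decide +kernel)

theorem approxL_lambertG : ApproxL (lambertG 3) lambertGSeries 6 :=
  approxL_of_functional_eq (d := 2) (D := [1, -1]) (U := [0, 1]) (W := [1, -1]) (by norm_num)
    (fun y h0 h1 => by simp only [evalL]; push_cast; linarith)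
    (fun y h0 h1 => by
      have hy : |y| < 1 := by rw [abs_of_pos h0]; linarith
      have h2 : y / (1 - y) * (1 - y) = y := div_mul_cancel₀ _ (by linarith)
      simp only [evalL]
      push_cast
      linear_combination (1 - y) * lambertG_eq (d := 3) (by norm_num) hy + h2)
    (exists_abs_lambertG_le (by norm_num)) (by decide +kernel)

theorem approxL_lambertF : ApproxL (lambertF 3) lambertFSeries 6 :=
  approxL_of_functional_eq (d := 2) (D := [1, 1]) (U := [0, 1]) (W := [1, 1]) (by norm_num)
    (fun y h0 h1 => by simp only [evalL]; push_cast; linarith)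
    (fun y h0 h1 => by
      have hy : |y| < 1 := by rw [abs_of_pos h0]; linarith
      have h2 : y / (1 + y) * (1 + y) = y := div_mul_cancel₀ _ (by linarith)
      simp only [evalL]
      push_cast
      linear_combination (1 + y) * lambertF_eq (d := 3) (by norm_num) hy + h2)
    (exists_abs_lambertF_le (by norm_num)) (by decide +kernel)

/-! ### Hermite–Padé tables -/

/-- In all four Stern tables `q` has `n + 1` coefficients subject to `r₁ + r₂ = n - 2` linear
conditions, which leaves at least the three dimensions needed. Taking `n₁ = n₂ = n - 1` balances `1
+ n` (from the sum in `sternB`) against `2 + n₁` (from the product); both equal `E`. -/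
theorem approxForms_stern_21 {b : ℕ} (hb : 2 ≤ b) :
    ApproxForms b 2 (sternA (1 / (b : ℝ))) (sternB (1 / (b : ℝ))) 21 8 :=
  approxForms_of_levels (n := 20) (n₁ := 19) (n₂ := 19) (r₁ := 9) (r₂ := 9) (m := 29)
    (levelDenominator_one b 2) (levelExpansion_sternA hb) (levelExpansion_sternB hb)
    (approxL_sternA.mono (by norm_num)) (approxL_sternB.mono (by norm_num))
    hb (by norm_num) (by norm_num)
    ![[2, -8, 2, 5, -7, 2, 5, -7, 2, 5, -7, 2, 7, -2, -3, -1, -2, 8],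
    [-2, 8, -2, -11, 13, 2, -15, 9, 6, -15, 9, 10, -21, 2, 17, -9, -2, 0, -4, 4],
    [-2, 4, 6, -11, 1, 14, -11, -7, 14, -7, -7, 18, -9, -18, 17, 7, -10, 0, -4, 0, 4]]
    (by decide +kernel) (by decide +kernel) (by decide +kernel) (by decide +kernel)
    (by norm_num) (by norm_num) (by norm_num) (by norm_num) (by norm_num) (by norm_num)
    (by norm_num) (by norm_num)

theorem approxForms_stern_23 {b : ℕ} (hb : 2 ≤ b) :
    ApproxForms b 2 (sternA (1 / (b : ℝ))) (sternB (1 / (b : ℝ))) 23 9 :=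
  approxForms_of_levels (n := 22) (n₁ := 21) (n₂ := 21) (r₁ := 10) (r₂ := 10) (m := 32)
    (levelDenominator_one b 2) (levelExpansion_sternA hb) (levelExpansion_sternB hb)
    (approxL_sternA.mono (by norm_num)) (approxL_sternB.mono (by norm_num))
    hb (by norm_num) (by norm_num)
    ![[5, 2, -4, 2, -9, 0, 9, -9, 0, 9, -9, 0, 14, -7, -4, 11, -9, -9, 9],
    [-2, 7, -2, -2, 0, -9, 9, 0, -9, 9, 0, -9, 7, 7, -11, 7, 9, -18, 0, 9],
    [8, 8, -10, -1, 0, -9, 0, 9, 0, -9, 0, 9, -1, 8, 8, -19, -9, 9, 0, 0, 0, -9, 9]]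
    (by decide +kernel) (by decide +kernel) (by decide +kernel) (by decide +kernel)
    (by norm_num) (by norm_num) (by norm_num) (by norm_num) (by norm_num) (by norm_num)
    (by norm_num) (by norm_num)

theorem approxForms_stern_27 {b : ℕ} (hb : 2 ≤ b) :
    ApproxForms b 2 (sternA (1 / (b : ℝ))) (sternB (1 / (b : ℝ))) 27 11 :=
  approxForms_of_levels (n := 26) (n₁ := 25) (n₂ := 25) (r₁ := 12) (r₂ := 12) (m := 38)
    (levelDenominator_one b 2) (levelExpansion_sternA hb) (levelExpansion_sternB hb)
    (approxL_sternA.mono (by norm_num)) (approxL_sternB.mono (by norm_num))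
    hb (by norm_num) (by norm_num)
    ![[-77, -22, 109, 12, 23, 64, -116, -14, 111, -64, -57, 22, -109, -12, 208, 2, -76, 74, -94,
     -46, 121, -42, -89, 32, 67],
    [22, -99, -12, 121, -64, 87, 14, -130, 64, 47, -22, -35, 12, -121, -2, 210, -74, -2, 46,
     -140, 42, 79, -32, -57, 0, 67],
    [24, -41, -74, 65, -15, 34, 64, -87, 15, 33, -24, 41, 7, -132, -57, 156, -32, 10, 105,
     -171, -9, 141, -41, -50, 0, 0, 67]]
    (by decide +kernel) (by decide +kernel) (by decide +kernel) (by decide +kernel)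
    (by norm_num) (by norm_num) (by norm_num) (by norm_num) (by norm_num) (by norm_num)
    (by norm_num) (by norm_num)

theorem approxForms_stern_33 {b : ℕ} (hb : 2 ≤ b) :
    ApproxForms b 2 (sternA (1 / (b : ℝ))) (sternB (1 / (b : ℝ))) 33 14 :=
  approxForms_of_levels (n := 32) (n₁ := 31) (n₂ := 31) (r₁ := 15) (r₂ := 15) (m := 47)
    (levelDenominator_one b 2) (levelExpansion_sternA hb) (levelExpansion_sternB hb)
    (approxL_sternA.mono (by norm_num)) (approxL_sternB.mono (by norm_num))
    hb (by norm_num) (by norm_num)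
    ![[0, -67, 99, 97, -228, 136, 60, -245, 201, 88, -273, 43, 246, -258, 12, 326, -354, 51,
     255, -293, 54, 136, -126, -5, 99, 4, -135, 82, 69, -133, 48],
    [0, 2, 0, -2, 0, -2, 0, 1, 0, 1, 0, 1, 0, 0, 0, -1, 0, -3, 0, 1, 0, 4, 0, -2, 0, -2, 0, 1,
     0, -1, 0, 3],
    [16, 35, -19, -65, 68, -56, -76, 133, -73, -56, 161, -11, -102, 114, 4, -166, 114, -3,
     -175, 133, 26, -56, 110, -11, -67, -20, 23, -2, -53, 53, 0, 0, 48]]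
    (by decide +kernel) (by decide +kernel) (by decide +kernel) (by decide +kernel)
    (by norm_num) (by norm_num) (by norm_num) (by norm_num) (by norm_num) (by norm_num)
    (by norm_num) (by norm_num)

/-- The degrees 7, 6, 8 balance the denominators: `1 + 7`, `2 + 6` and `0 + 8` all equal `E = 8`.
Eight coefficients meet four conditions. -/
theorem approxForms_thueMorse {b : ℕ} (hb : 2 ≤ b) :
    ApproxForms b 2 (thueMorseT (1 / (b : ℝ))) (thueMorseM (1 / (b : ℝ))) 8 2 :=
  approxForms_of_levels (n := 7) (n₁ := 6) (n₂ := 8) (r₁ := 3) (r₂ := 1) (m := 10)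
    (levelDenominator_thueMorse hb) (levelExpansion_thueMorseT hb) (levelExpansion_thueMorseM hb)
    approxL_thueMorseT approxL_thueMorseM
    hb (by norm_num) (by norm_num)
    ![[-1, 1, -1, 1],
    [0, 0, 0, 0, 1, 1],
    [0, 0, 1, 0, 0, 0, 1]]
    (by decide +kernel) (by decide +kernel) (by decide +kernel) (by decide +kernel)
    (by norm_num) (by norm_num) (by norm_num) (by norm_num) (by norm_num) (by norm_num)
    (by norm_num) (by norm_num)

/-- Here `s = 3`, so `E = 2 + 3 * 4` and `ρ = 3 * 6 - 14`. Five coefficients meet two conditions. -/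
theorem approxForms_lambert {b : ℕ} (hb : 2 ≤ b) :
    ApproxForms b 3 (lambertG 3 (1 / (b : ℝ))) (lambertF 3 (1 / (b : ℝ))) 14 4 :=
  approxForms_of_levels (n := 4) (n₁ := 4) (n₂ := 4) (r₁ := 1) (r₂ := 1) (m := 6)
    (levelDenominator_lambert hb (by norm_num)) (levelExpansion_lambertG hb (by norm_num)) (levelExpansion_lambertF hb (by norm_num))
    approxL_lambertG approxL_lambertF
    hb (by norm_num) (by norm_num)
    ![[-2, 0, 1],
    [0, -1, 0, 1],
    [-1, 0, 0, 0, 1]]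
    (by decide +kernel) (by decide +kernel) (by decide +kernel) (by decide +kernel)
    (by norm_num) (by norm_num) (by norm_num) (by norm_num) (by norm_num) (by norm_num)
    (by norm_num) (by norm_num)

theorem mainTheorem7 (b : ℕ) (hb : 2 ≤ b) :
    linIndepExponent (sternA (1 / (b : ℝ))) (sternB (1 / (b : ℝ))) ≤ 3 ∧
    linIndepExponent (thueMorseT (1 / (b : ℝ))) (thueMorseM (1 / (b : ℝ))) ≤ 15 ∧
    linIndepExponent (lambertG 3 (1 / (b : ℝ))) (lambertF 3 (1 / (b : ℝ))) ≤ 17 := by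
  refine ⟨?_, ?_, ?_⟩
  · refine linIndepExponent_le_of_approxForms (d := 2) (g := 4) (μ := 3)
      -- The chain is `23 ≤ 3 * 8`, `27 ≤ 3 * 9`, `33 ≤ 3 * 11`, and `2 * 21 ≤ 3 * 14` on passing to
      -- the next level; all but the first are equalities.
      (E := fun i => [21, 23, 27, 33].getD i 0) (ρ := fun i => [8, 9, 11, 14].getD i 0)
      hb le_rfl (by norm_num) (by decide) (fun i hi => ?_) (by decide) fun i hi => ?_
    · have : i < 3 := by omega
      interval_cases i <;> decide
    · interval_cases i
      · exact approxForms_stern_21 hb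
      · exact approxForms_stern_23 hb
      · exact approxForms_stern_27 hb
      · exact approxForms_stern_33 hb
  -- With one table only the wrap condition remains: `2 * 8 ≤ 15 * 2` here and `3 * 14 ≤ 17 * 4` for
  -- the Lambert pair, both with room to spare.
  · exact linIndepExponent_le_of_approxForms (d := 2) (g := 1) (μ := 15) (E := fun _ => 8)
      (ρ := fun _ => 2) hb le_rfl one_pos (by norm_num) (fun i hi => by omega) (by norm_num)
      fun _ _ => approxForms_thueMorse hb
  · exact linIndepExponent_le_of_approxForms (d := 3) (g := 1) (μ := 17) (E := fun _ => 14)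
      (ρ := fun _ => 4) hb (by norm_num) one_pos (by norm_num) (fun i hi => by omega)
      (by norm_num) fun _ _ => approxForms_lambert hb
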